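/- Let $0<T\le\infty$, put $\Delta=(0,T]$ (so $\Delta=(0,\infty)$ if $T=\infty$) and $x+\Delta=(x,x+T]$. For functions $g,h$ write $g(x)\sim h(x)$ if $g(x)/h(x)\to1$ as $x\to\infty$. A probability distribution $G$ on $\mathbb R$ belongs to the class $\mathcal L_\Delta$ if $G(x+\Delta)>0$ for all sufficiently large $x$ and $G(x+t+\Delta)/G(x+\Delta)\to1$ as $x\to\infty$, uniformly in $t\in[0,1]$. A probability distribution $G$ on $[0,\infty)$ with unbounded support belongs to the class $\mathcal S_\Delta$ if $G\in\mathcal L_\Delta$ and $(G*G)(x+\Delta)\sim 2G(x+\Delta)$. Let $F$ be an infinitely divisible probability law on $[0,\infty)$ with Lévy measure $\nu$; that is, $\nu$ is a Borel measure on $(0,\infty)$ with $\nu((1,\infty))<\infty$ and $\int_{(0,1]}x\,\nu(dx)<\infty$ such that, for some constant $a\ge0$ and all $\lambda>0$, $$\int_{[0,\infty)}e^{-\lambda x}F(dx)=\exp\Bigl(-a\lambda-\int_{(0,\infty)}(1-e^{-\lambda x})\,\nu(dx)\Bigr).$$ Assume that $\mu=\nu((1,\infty))>0$, and let $G$ be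 the probability distribution $G(B)=\nu(B\cap(1,\infty))/\mu$. If $T<\infty$, assume in addition that $G\in\mathcal L_\Delta$. Then the following assertions are equivalent: (i) $G\in\mathcal S_\Delta$; (ii) $\nu(x+\Delta)\sim F(x+\Delta)$ as $x\to\infty$. -/

import Mathlib

open Set Filter Topology MeasureTheory ProbabilityTheory
open scoped ENNReal

namespace LocalSubexp

/-- The interval `x + Δ = (x, x + T]`, where `Δ = (0, T]` and `0 < T ≤ ∞`;
it is `(x, ∞)` when `T = ∞`. -/
def window (T : ℝ≥0∞) (x : ℝ) : Set ℝ :=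
  {y | x < y ∧ ENNReal.ofReal (y - x) ≤ T}

theorem window_top (x : ℝ) : window ∞ x = Ioi x := by
  ext y
  simp [window]

theorem window_ofReal {t : ℝ} (ht : 0 ≤ t) (x : ℝ) :
    window (ENNReal.ofReal t) x = Ioc x (x + t) := by
  ext y
  simp only [window, mem_ofPred_eq, mem_Ioc, ENNReal.ofReal_le_ofReal_iff ht]
  constructor <;> rintro ⟨h1, h2⟩ <;> exact ⟨h1, by linarith⟩

/-- The class `L_Δ`: probability distributions `G` on `ℝ` with `G(x + Δ) > 0` for all large `x`
and `G(x + t + Δ) / G(x + Δ) → 1` as `x → ∞`, uniformly in `t ∈ [0, 1]`. -/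
structure LongTailed (T : ℝ≥0∞) (G : Measure ℝ) : Prop where
  isProb : IsProbabilityMeasure G
  eventually_pos : ∀ᶠ x : ℝ in atTop, 0 < G.real (window T x)
  tendsto_ratio : TendstoUniformlyOn
    (fun x t : ℝ => G.real (window T (x + t)) / G.real (window T x))
    (fun _ => (1 : ℝ)) atTop (Icc 0 1)

/-- The class `S_Δ` of `Δ`-subexponential distributions: distributions `G` on `[0, ∞)` with
unbounded support, `G ∈ L_Δ`, and `(G * G)(x + Δ) ~ 2 G(x + Δ)` as `x → ∞`. -/
structure Subexponential (T : ℝ≥0∞) (G : Measure ℝ) : Prop where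
  nonneg : G (Iio 0) = 0
  unbounded : ∀ x : ℝ, 0 < G (Ioi x)
  longTailed : LongTailed T G
  conv_self : Tendsto
    (fun x : ℝ => (G.conv G).real (window T x) / (2 * G.real (window T x))) atTop (𝓝 1)

/-- The `n`-th convolution power of a measure on `ℝ`. -/
noncomputable def convPow (H : Measure ℝ) : ℕ → Measure ℝ
  | 0 => Measure.dirac 0
  | n + 1 => (convPow H n).conv H

/-- `F` is infinitely divisible: it is the `n`-th convolution power of a probability measure,
for every `n ≥ 1`. -/
def InfinitelyDivisible (F : Measure ℝ) : Prop :=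
  ∀ n : ℕ, 1 ≤ n → ∃ H : Measure ℝ, IsProbabilityMeasure H ∧ convPow H n = F

/-- `ν` is the Lévy measure of the law `F` on `[0, ∞)`: it is a Borel measure on `(0, ∞)` with
`ν((1, ∞)) < ∞` and `∫_(0,1] x ν(dx) < ∞`, and for some drift `a ≥ 0`
`∫ exp(-λ x) F(dx) = exp(-a λ - ∫_(0,∞) (1 - exp(-λ x)) ν(dx))` for all `λ > 0`. -/
structure IsLevyMeasure (F ν : Measure ℝ) : Prop where
  nonpos_null : ν (Iic 0) = 0
  tail_finite : ν (Ioi 1) < ∞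
  small_jumps : ∫⁻ x in Ioc (0 : ℝ) 1, ENNReal.ofReal x ∂ν < ∞
  laplace : ∃ a : ℝ, 0 ≤ a ∧ ∀ l : ℝ, 0 < l →
    ∫ x, Real.exp (-l * x) ∂F
      = Real.exp (-a * l - ∫ x in Ioi (0 : ℝ), (1 - Real.exp (-l * x)) ∂ν)

end LocalSubexp

/-!
Write `g x = G (x + Δ)` and `m = ν (1, ∞)`. By uniqueness of Laplace transforms, `F` is the
convolution of a law `M` carrying the drift and the jumps of size at most `1`, and of the compound
Poisson law `∑ e^{-m} m^n / n! G^{*n}` of the larger jumps (`IsLevyMeasure.exists_eq_conv`). The law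
`M` is built as an infinite convolution of compound Poisson laws; its jumps are bounded, so it has
exponential moments. Since `ν (x + Δ) = m * g x` for `x ≥ 1`, the claim is that `G` is
`Δ`-subexponential if and only if `F (x + Δ) ~ m * g x`.

The basic tool is the decomposition `conv_window_split`: for `x ≥ 2 A`, a sum lies in `x + Δ`
either with one summand at most `A`, or with both summands larger than `A`. The first kind is
governed by long-tailedness. The second kind, `bothLarge`, can be compared between different laws
(`bothLarge_le`), and for a `Δ`-subexponential `G` it is negligible with respect to `g`. So if
`M₁` and `M₂` have `Δ`-tails asymptotic to `a * g` and `b * g`, then `M₁ * M₂` has `Δ`-tails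
asymptotic to `(a * M₂(ℝ) + b * M₁(ℝ)) * g` (`AsympGE.conv`, `AsympLE.conv`).

If `G` is `Δ`-subexponential, then `G^{*n} (x + Δ) ~ n * g x`, and `G^{*n} (x + Δ) ≤ K ^ n * g x`
for large `x` (`Subexponential.exists_convPow_le`). As Poisson weights are summable against `K ^ n`,
dominated convergence gives the tails of the compound Poisson law, and convolution with `M`, whose
tail is `o(g)`, does not change them.

Conversely, each term of `F = ∑ e^{-m} m^n / n! M * G^{*n}` is asymptotically at least `n * g`, and
these lower bounds already add up to `m * g`. So the term `n = 2` is asymptotically at most `2 * g`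
(`asympLE_conv_conv_self`). For `T < ∞` long-tailedness of `G` allows one to remove `M`
(`LongTailed.negligibleBoth_of_conv`). For `T = ∞` this is immediate because tails are monotone, and
long-tailedness itself follows from `limsup (G * G) / G ≤ 2` (`longTailed_top_of_conv_self`).
-/

namespace LocalSubexp

/-! ### Windows and convolutions -/

theorem measurableSet_window (T : ℝ≥0∞) (x : ℝ) : MeasurableSet (window T x) := by
  have h1 : MeasurableSet {y : ℝ | x < y} := measurableSet_Ioi
  have h2 : MeasurableSet {y : ℝ | ENNReal.ofReal (y - x) ≤ T} :=
    measurableSet_le (by fun_prop) measurable_const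
  exact h1.inter h2

theorem mem_window {T : ℝ≥0∞} {x y : ℝ} :
    y ∈ window T x ↔ x < y ∧ ENNReal.ofReal (y - x) ≤ T := Iff.rfl

theorem window_subset_Ioi (T : ℝ≥0∞) (x : ℝ) : window T x ⊆ Ioi x := fun _ h => h.1

theorem add_mem_window_iff {T : ℝ≥0∞} {x y z : ℝ} :
    y + z ∈ window T x ↔ z ∈ window T (x - y) := by
  rw [mem_window, mem_window, sub_lt_iff_lt_add']
  ring_nf

theorem conv_window_eq_lintegral (T : ℝ≥0∞) (M N : Measure ℝ) [SFinite M] [SFinite N] (x : ℝ) :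
    (M.conv N) (window T x) = ∫⁻ y, M (window T (x - y)) ∂N := by
  rw [Measure.conv_comm, Measure.conv,
    Measure.map_apply measurable_add (measurableSet_window T x),
    Measure.prod_apply (measurable_add (measurableSet_window T x))]
  refine lintegral_congr fun y => congrArg M ?_
  ext z
  exact add_mem_window_iff

theorem measurable_measure_window (T : ℝ≥0∞) (M : Measure ℝ) [SFinite M] (x : ℝ) :
    Measurable fun y => M (window T (x - y)) := by
  have h := measurable_measure_prodMk_left (ν := M)
    (measurable_add (M := ℝ) (measurableSet_window T x))
  convert h using 3 with y
  ext z
  exact add_mem_window_iff.symm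

theorem integrable_measureReal_window (T : ℝ≥0∞) (M N : Measure ℝ) [IsFiniteMeasure M]
    [IsFiniteMeasure N] (x : ℝ) : Integrable (fun y => M.real (window T (x - y))) N := by
  refine Integrable.of_bound
    (measurable_measure_window T M x).ennreal_toReal.aestronglyMeasurable (M.real univ) ?_
  refine Eventually.of_forall fun y => ?_
  rw [Real.norm_of_nonneg measureReal_nonneg]
  exact measureReal_mono (subset_univ _)

theorem conv_real_window (T : ℝ≥0∞) (M N : Measure ℝ) [IsFiniteMeasure M] [IsFiniteMeasure N]
    (x : ℝ) : (M.conv N).real (window T x) = ∫ y, M.real (window T (x - y)) ∂N := by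
  rw [measureReal_def, conv_window_eq_lintegral, ← integral_toReal]
  · rfl
  · exact (measurable_measure_window T M x).aemeasurable
  · exact Eventually.of_forall fun y => measure_lt_top _ _

/-- Lower bound for a convolution whose second factor is restricted to a set. -/
theorem mul_le_conv_restrict (T : ℝ≥0∞) (M N : Measure ℝ) [IsFiniteMeasure M] [IsFiniteMeasure N]
    {S : Set ℝ} (hS : MeasurableSet S) {x c : ℝ}
    (h : ∀ᵐ y ∂N, y ∈ S → c ≤ M.real (window T (x - y))) :
    c * N.real S ≤ (M.conv (N.restrict S)).real (window T x) := by
  rw [conv_real_window]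
  calc c * N.real S = ∫ _ in S, c ∂N := by simp [mul_comm]
    _ ≤ _ := integral_mono_ae (by simp) (integrable_measureReal_window T M _ x)
      ((ae_restrict_iff' hS).2 h)

/-- Upper bound for a convolution whose second factor is restricted to a set. -/
theorem conv_restrict_le_mul (T : ℝ≥0∞) (M N : Measure ℝ) [IsFiniteMeasure M] [IsFiniteMeasure N]
    {S : Set ℝ} (hS : MeasurableSet S) {x c : ℝ}
    (h : ∀ᵐ y ∂N, y ∈ S → M.real (window T (x - y)) ≤ c) :
    (M.conv (N.restrict S)).real (window T x) ≤ c * N.real S := by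
  rw [conv_real_window]
  refine (integral_mono_ae (integrable_measureReal_window T M _ x) (integrable_const c)
    ((ae_restrict_iff' hS).2 h)).trans ?_
  simp [mul_comm]

theorem conv_window_mono_left (T : ℝ≥0∞) {M M' N : Measure ℝ} [IsFiniteMeasure M]
    [IsFiniteMeasure M'] [IsFiniteMeasure N] (h : M ≤ M') (x : ℝ) :
    (M.conv N).real (window T x) ≤ (M'.conv N).real (window T x) := by
  rw [conv_real_window, conv_real_window]
  refine integral_mono (integrable_measureReal_window T M _ x)
    (integrable_measureReal_window T M' _ x) fun y => ?_
  exact ENNReal.toReal_mono (measure_ne_top _ _) (h _)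

theorem ae_nonneg {N : Measure ℝ} (hN : N (Iio 0) = 0) : ∀ᵐ y ∂N, 0 ≤ y := by
  rw [ae_iff]
  simpa [Iio_def] using hN

theorem conv_Iio_zero {M N : Measure ℝ} [IsFiniteMeasure M] [IsFiniteMeasure N]
    (hM : M (Iio 0) = 0) (hN : N (Iio 0) = 0) : (M.conv N) (Iio 0) = 0 := by
  rw [Measure.conv, Measure.map_apply measurable_add measurableSet_Iio,
    Measure.prod_apply (measurable_add measurableSet_Iio), lintegral_eq_zero_iff']
  · filter_upwards [ae_nonneg hM] with y hy
    refine measure_mono_null ?_ hN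
    intro z hz
    simp only [mem_preimage, mem_Iio] at hz ⊢
    linarith
  · exact (measurable_measure_prodMk_left (measurable_add measurableSet_Iio)).aemeasurable

/-- The mass near `x` of the convolution of `M` and `N`, when both summands exceed `A`. -/
noncomputable def bothLarge (T : ℝ≥0∞) (M N : Measure ℝ) (A x : ℝ) : ℝ :=
  ((M.restrict (Ioi A)).conv (N.restrict (Ioi A))).real (window T x)

theorem bothLarge_comm (T : ℝ≥0∞) (M N : Measure ℝ) [IsFiniteMeasure M] [IsFiniteMeasure N]
    (A x : ℝ) : bothLarge T M N A x = bothLarge T N M A x := by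
  rw [bothLarge, Measure.conv_comm, bothLarge]

theorem bothLarge_nonneg (T : ℝ≥0∞) (M N : Measure ℝ) (A x : ℝ) : 0 ≤ bothLarge T M N A x :=
  measureReal_nonneg

/-- Beyond `2 A`, at most one of the two summands of a sum is at most `A`. -/
theorem conv_window_split (T : ℝ≥0∞) (M N : Measure ℝ) [IsFiniteMeasure M] [IsFiniteMeasure N]
    {A x : ℝ} (hx : 2 * A ≤ x) :
    (M.conv N).real (window T x) = (M.conv (N.restrict (Iic A))).real (window T x)
      + (N.conv (M.restrict (Iic A))).real (window T x) + bothLarge T M N A x := by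
  have hM : M.restrict (Iic A) + M.restrict (Ioi A) = M := by
    rw [← compl_Iic]; exact Measure.restrict_add_restrict_compl measurableSet_Iic
  have hN : N.restrict (Iic A) + N.restrict (Ioi A) = N := by
    rw [← compl_Iic]; exact Measure.restrict_add_restrict_compl measurableSet_Iic
  -- Two summands at most `A` have sum at most `2 A ≤ x`, outside the window.
  have h0 : ((N.restrict (Iic A)).conv (M.restrict (Iic A))).real (window T x) = 0 := by
    rw [conv_real_window]
    refine integral_eq_zero_of_ae ?_
    filter_upwards [ae_restrict_mem measurableSet_Iic] with y hy
    rw [measureReal_restrict_apply (measurableSet_window _ _)]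
    have : window T (x - y) ∩ Iic A = ∅ := by
      ext z
      simp only [mem_inter_iff, mem_Iic, mem_empty_iff_false, iff_false, not_and, not_le] at hy ⊢
      intro hz
      linarith [hz.1]
    simp [this]
  have e1 : (M.conv N) = M.conv (N.restrict (Iic A)) + M.conv (N.restrict (Ioi A)) := by
    rw [← Measure.conv_add, hN]
  have e2 : M.conv (N.restrict (Ioi A)) = (M.restrict (Iic A)).conv (N.restrict (Ioi A))
      + (M.restrict (Ioi A)).conv (N.restrict (Ioi A)) := by
    rw [← Measure.add_conv, hM]
  have e3 : N.conv (M.restrict (Iic A)) = (N.restrict (Iic A)).conv (M.restrict (Iic A))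
      + (N.restrict (Ioi A)).conv (M.restrict (Iic A)) := by
    rw [← Measure.add_conv, hN]
  rw [e1, measureReal_add_apply, e2, measureReal_add_apply, e3, measureReal_add_apply, h0,
    Measure.conv_comm (M.restrict (Iic A)), bothLarge]
  ring

/-- Comparison of `bothLarge` when the first summand is replaced by one with heavier windows; the
last term accounts for a first summand within one window of the level `A'`. -/
theorem bothLarge_le (T : ℝ≥0∞) (M M' N : Measure ℝ) [IsFiniteMeasure M] [IsFiniteMeasure M']
    [IsFiniteMeasure N] {A A' z C : ℝ} (hz : 0 ≤ z) (hA : A + z ≤ A') (hC : 0 ≤ C)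
    (h : ∀ w, A' ≤ w → M.real (window T w) ≤ C * M'.real (window T (w - z))) (x : ℝ) :
    bothLarge T M N A' x ≤ C * bothLarge T M' N A (x - z)
      + M.real (window T A') * N.real (window T (x - A')) := by
  rw [bothLarge, bothLarge, conv_real_window, conv_real_window]
  set f : ℝ → ℝ := fun y => C * (M'.restrict (Ioi A)).real (window T (x - z - y)) with hf
  set e : ℝ → ℝ := (window T (x - A')).indicator fun _ => M.real (window T A') with he
  have hfi : Integrable f N := (integrable_measureReal_window T _ _ _).const_mul C
  have hei : Integrable e N := (integrable_const _).indicator (measurableSet_window _ _)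
  have hf0 : ∀ y, 0 ≤ f y := fun y => mul_nonneg hC measureReal_nonneg
  have he0 : ∀ y, 0 ≤ e y := fun y => indicator_nonneg (fun _ _ => measureReal_nonneg) y
  have key : ∀ y, (M.restrict (Ioi A')).real (window T (x - y)) ≤ f y + e y := by
    intro y
    -- If `y ≤ x - A'`, the whole window around `x - y` lies above `A'`. Otherwise the part of it
    -- above `A'` is contained in the window at `A'`, and is empty unless `y` is near `x - A'`.
    rcases le_or_gt y (x - A') with hy | hy
    · have h1 := h (x - y) (by linarith)
      have h2 : (M.restrict (Ioi A')).real (window T (x - y)) ≤ M.real (window T (x - y)) := by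
        rw [measureReal_restrict_apply (measurableSet_window _ _)]
        exact measureReal_mono inter_subset_left
      have h3 : M'.real (window T (x - y - z)) = (M'.restrict (Ioi A)).real
          (window T (x - z - y)) := by
        rw [measureReal_restrict_apply (measurableSet_window _ _), inter_eq_left.2]
        · congr 2; ring
        · intro w hw
          have := hw.1
          simp only [mem_Ioi]; linarith
      rw [h3] at h1
      linarith [he0 y]
    · rw [measureReal_restrict_apply (measurableSet_window _ _)]
      rcases (window T (x - y) ∩ Ioi A').eq_empty_or_nonempty with h0 | ⟨w, hw⟩
      · rw [h0]; simp only [measureReal_empty]; linarith [he0 y, hf0 y]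
      · have hmem : y ∈ window T (x - A') := by
          refine ⟨hy, le_trans (ENNReal.ofReal_le_ofReal ?_) hw.1.2⟩
          have := hw.2
          simp only [mem_Ioi] at this
          linarith
        have : e y = M.real (window T A') := by simp [he, hmem]
        rw [this]
        refine (measureReal_mono (fun v hv => ?_)).trans (le_add_of_nonneg_left (hf0 y))
        refine ⟨hv.2, le_trans (ENNReal.ofReal_le_ofReal ?_) hv.1.2⟩
        linarith
  calc _ ≤ ∫ y in Ioi A', (f y + e y) ∂N :=
        integral_mono (integrable_measureReal_window T _ _ _)
          (hfi.integrableOn.add hei.integrableOn) key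
    _ = (∫ y in Ioi A', f y ∂N) + ∫ y in Ioi A', e y ∂N :=
        integral_add hfi.integrableOn hei.integrableOn
    _ ≤ (∫ y in Ioi A, f y ∂N) + ∫ y, e y ∂N := by
        refine add_le_add ?_ ?_
        · refine setIntegral_mono_set hfi.integrableOn (Eventually.of_forall hf0) ?_
          exact (Ioi_subset_Ioi (by linarith)).eventuallyLE
        · exact setIntegral_le_integral hei (Eventually.of_forall he0)
    _ = _ := by
        rw [hf, integral_const_mul, he, integral_indicator_const _ (measurableSet_window _ _)]
        simp [mul_comm]

/-! ### Asymptotic inequalities -/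

/-- `h` is asymptotically at least `m * g`, in the sense `liminf h / g ≥ m`; written without a
quotient, so that it makes sense wherever `g` vanishes. -/
def AsympGE (g h : ℝ → ℝ) (m : ℝ) : Prop :=
  ∀ ε : ℝ, 0 < ε → ∀ᶠ x in atTop, (m - ε) * g x ≤ h x

/-- `h` is asymptotically at most `m * g`, in the sense `limsup h / g ≤ m`. -/
def AsympLE (g h : ℝ → ℝ) (m : ℝ) : Prop :=
  ∀ ε : ℝ, 0 < ε → ∀ᶠ x in atTop, h x ≤ (m + ε) * g x

/-- `g` does not drop under bounded shifts to the left: `liminf g (x - y) / g x ≥ 1`, locally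
uniformly in `y ≥ 0`. -/
def ShiftGE (g : ℝ → ℝ) : Prop :=
  ∀ A ε : ℝ, 0 < ε → ∀ᶠ x in atTop, ∀ y ∈ Icc 0 A, (1 - ε) * g x ≤ g (x - y)

/-- `g` does not grow under bounded shifts to the left: `limsup g (x - y) / g x ≤ 1`, locally
uniformly in `y ≥ 0`. -/
def ShiftLE (g : ℝ → ℝ) : Prop :=
  ∀ A ε : ℝ, 0 < ε → ∀ᶠ x in atTop, ∀ y ∈ Icc 0 A, g (x - y) ≤ (1 + ε) * g x

theorem tendsto_div_iff_asymp {g h : ℝ → ℝ} (hg : ∀ᶠ x in atTop, 0 < g x) {m : ℝ} :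
    Tendsto (fun x => h x / g x) atTop (𝓝 m) ↔ AsympGE g h m ∧ AsympLE g h m := by
  constructor
  · intro H
    refine ⟨fun ε hε => ?_, fun ε hε => ?_⟩
    · filter_upwards [hg, H.eventually_const_le (show m - ε < m by linarith)] with x h1 h2
      exact (le_div_iff₀ h1).1 h2
    · filter_upwards [hg, H.eventually_le_const (show m < m + ε by linarith)] with x h1 h2
      exact (div_le_iff₀ h1).1 h2
  · rintro ⟨H1, H2⟩
    rw [Metric.tendsto_nhds]
    intro ε hε
    filter_upwards [hg, H1 (ε / 2) (by linarith), H2 (ε / 2) (by linarith)] with x h0 h1 h2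
    rw [Real.dist_eq, abs_lt]
    rw [← le_div_iff₀ h0] at h1
    rw [← div_le_iff₀ h0] at h2
    constructor <;> linarith

theorem asympGE_refl (T : ℝ≥0∞) (G : Measure ℝ) :
    AsympGE (fun x => G.real (window T x)) (fun x => G.real (window T x)) 1 :=
  fun ε hε => Eventually.of_forall fun x => by
    nlinarith [measureReal_nonneg (μ := G) (s := window T x)]

theorem asympLE_refl (T : ℝ≥0∞) (G : Measure ℝ) :
    AsympLE (fun x => G.real (window T x)) (fun x => G.real (window T x)) 1 :=
  fun ε hε => Eventually.of_forall fun x => by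
    nlinarith [measureReal_nonneg (μ := G) (s := window T x)]

theorem asympGE_zero {g h : ℝ → ℝ} (hg : ∀ x, 0 ≤ g x) (hh : ∀ x, 0 ≤ h x) :
    AsympGE g h 0 := fun ε hε => Eventually.of_forall fun x =>
  (mul_nonpos_of_nonpos_of_nonneg (by linarith) (hg x)).trans (hh x)

theorem eventually_forall_sub_mem {P : ℝ → Prop} (h : ∀ᶠ x in atTop, P x) (A : ℝ) :
    ∀ᶠ x in atTop, ∀ y ∈ Icc 0 A, P (x - y) := by
  obtain ⟨x0, hx0⟩ := eventually_atTop.1 h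
  filter_upwards [eventually_ge_atTop (x0 + A)] with x hx y hy
  exact hx0 _ (by linarith [hy.2])

theorem AsympGE.shift {g h : ℝ → ℝ} {m : ℝ} (hg0 : ∀ x, 0 ≤ g x) (hh0 : ∀ x, 0 ≤ h x)
    (hs : ShiftGE g) (hh : AsympGE g h m) (A ε : ℝ) (hε : 0 < ε) :
    ∀ᶠ x in atTop, ∀ y ∈ Icc 0 A, (m - ε) * g x ≤ h (x - y) := by
  rcases le_or_gt (m - ε) 0 with hm | hm
  · exact Eventually.of_forall fun x y _ =>
      (mul_nonpos_of_nonpos_of_nonneg hm (hg0 x)).trans (hh0 _)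
  · have hm0 : 0 < m := by linarith
    have hη : 0 < ε / (2 * m) := by positivity
    filter_upwards [eventually_forall_sub_mem (hh (ε / 2) (by linarith)) A, hs A _ hη]
      with x h1 h2 y hy
    have e : m * (ε / (2 * m)) = ε / 2 := by field_simp
    calc (m - ε) * g x ≤ ((m - ε / 2) * (1 - ε / (2 * m))) * g x := by
          refine mul_le_mul_of_nonneg_right ?_ (hg0 x)
          have : 0 ≤ ε / 2 * (ε / (2 * m)) := by positivity
          nlinarith
      _ = (m - ε / 2) * ((1 - ε / (2 * m)) * g x) := by ring
      _ ≤ (m - ε / 2) * g (x - y) := mul_le_mul_of_nonneg_left (h2 y hy) (by linarith)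
      _ ≤ _ := h1 y hy

theorem AsympLE.shift {g h : ℝ → ℝ} {m : ℝ} (hm : 0 ≤ m)
    (hs : ShiftLE g) (hh : AsympLE g h m) (A ε : ℝ) (hε : 0 < ε) :
    ∀ᶠ x in atTop, ∀ y ∈ Icc 0 A, h (x - y) ≤ (m + ε) * g x := by
  have hm0 : 0 < m + ε / 2 := by linarith
  have hη : 0 < ε / 2 / (m + ε / 2) := by positivity
  filter_upwards [eventually_forall_sub_mem (hh (ε / 2) (by linarith)) A, hs A _ hη]
    with x h1 h2 y hy
  calc h (x - y) ≤ (m + ε / 2) * g (x - y) := h1 y hy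
    _ ≤ (m + ε / 2) * ((1 + ε / 2 / (m + ε / 2)) * g x) :=
      mul_le_mul_of_nonneg_left (h2 y hy) hm0.le
    _ = (m + ε) * g x := by field_simp; ring

theorem exists_real_Iic_gt (M : Measure ℝ) [IsFiniteMeasure M] {η : ℝ} (hη : 0 < η) :
    ∃ A0, ∀ A, A0 ≤ A → M.real univ - η ≤ M.real (Iic A) := by
  have h : Tendsto (fun A => M.real (Iic A)) atTop (𝓝 (M.real univ)) :=
    (ENNReal.tendsto_toReal (measure_ne_top M _)).comp (tendsto_measure_Iic_atTop M)
  exact eventually_atTop.1 (h.eventually_const_le (by linarith))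

/-- Windows far to the right have small mass. -/
theorem exists_real_window_lt (T : ℝ≥0∞) (M : Measure ℝ) [IsFiniteMeasure M] {η : ℝ}
    (hη : 0 < η) : ∃ A0, ∀ A, A0 ≤ A → M.real (window T A) ≤ η := by
  obtain ⟨A0, h⟩ := exists_real_Iic_gt M hη
  refine ⟨A0, fun A hA => ?_⟩
  have h1 : M.real (window T A) ≤ M.real (Iic A)ᶜ :=
    measureReal_mono (by rw [compl_Iic]; exact window_subset_Ioi T A)
  rw [measureReal_compl measurableSet_Iic] at h1
  linarith [h A hA]

/-- The contribution to `M * N` near `x` of small values of the second summand, from below. -/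
theorem eventually_le_conv_restrict_Iic (T : ℝ≥0∞) {g : ℝ → ℝ} (hg0 : ∀ x, 0 ≤ g x)
    (hs : ShiftGE g) (M N : Measure ℝ) [IsFiniteMeasure M] [IsFiniteMeasure N]
    (hN : N (Iio 0) = 0) {m : ℝ} (hM : AsympGE g (fun x => M.real (window T x)) m)
    (A : ℝ) {ε : ℝ} (hε : 0 < ε) :
    ∀ᶠ x in atTop, (m - ε) * g x * N.real (Iic A)
      ≤ (M.conv (N.restrict (Iic A))).real (window T x) := by
  filter_upwards [hM.shift hg0 (fun _ => measureReal_nonneg) hs A ε hε] with x hx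
  refine mul_le_conv_restrict T M N measurableSet_Iic ?_
  filter_upwards [ae_nonneg hN] with y hy hyA
  exact hx y ⟨hy, hyA⟩

/-- The upper counterpart of `eventually_le_conv_restrict_Iic`. -/
theorem eventually_conv_restrict_Iic_le (T : ℝ≥0∞) {g : ℝ → ℝ}
    (hs : ShiftLE g) (M N : Measure ℝ) [IsFiniteMeasure M] [IsFiniteMeasure N]
    (hN : N (Iio 0) = 0) {m : ℝ} (hm : 0 ≤ m)
    (hM : AsympLE g (fun x => M.real (window T x)) m)
    (A : ℝ) {ε : ℝ} (hε : 0 < ε) :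
    ∀ᶠ x in atTop, (M.conv (N.restrict (Iic A))).real (window T x)
      ≤ (m + ε) * g x * N.real (Iic A) := by
  filter_upwards [hM.shift hm hs A ε hε] with x hx
  refine conv_restrict_le_mul T M N measurableSet_Iic ?_
  filter_upwards [ae_nonneg hN] with y hy hyA
  exact hx y ⟨hy, hyA⟩

/-- A sum is near `x` at least when one summand is and the other one is of order one. -/
theorem AsympGE.conv (T : ℝ≥0∞) {g : ℝ → ℝ} (hg0 : ∀ x, 0 ≤ g x)
    (hs : ShiftGE g) (M N : Measure ℝ) [IsFiniteMeasure M] [IsFiniteMeasure N]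
    (hM0 : M (Iio 0) = 0) (hN0 : N (Iio 0) = 0) {m n : ℝ} (hm : 0 ≤ m) (hn : 0 ≤ n)
    (hM : AsympGE g (fun x => M.real (window T x)) m)
    (hN : AsympGE g (fun x => N.real (window T x)) n) :
    AsympGE g (fun x => (M.conv N).real (window T x))
      (m * N.real univ + n * M.real univ) := by
  intro ε hε
  set K := m + n + M.real univ + N.real univ + 1 with hK
  have hM1 : 0 ≤ M.real univ := measureReal_nonneg
  have hN1 : 0 ≤ N.real univ := measureReal_nonneg
  have hK0 : 0 < K := by positivity
  set η := ε / K with hη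
  have hη0 : 0 < η := by positivity
  have hηK : η * K = ε := by rw [hη]; field_simp
  obtain ⟨A1, h1⟩ := exists_real_Iic_gt M hη0
  obtain ⟨A2, h2⟩ := exists_real_Iic_gt N hη0
  set A := max A1 A2 with hA
  filter_upwards [eventually_ge_atTop (2 * A),
    eventually_le_conv_restrict_Iic T hg0 hs M N hN0 hM A hη0,
    eventually_le_conv_restrict_Iic T hg0 hs N M hM0 hN A hη0] with x hx hx1 hx2
  rw [conv_window_split T M N hx]
  have h1 := h1 A (le_max_left _ _)
  have h2 := h2 A (le_max_right _ _)
  have h3 : M.real (Iic A) ≤ M.real univ := measureReal_mono (subset_univ _)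
  have h4 : N.real (Iic A) ≤ N.real univ := measureReal_mono (subset_univ _)
  have hJ := bothLarge_nonneg T M N A x
  have key : m * N.real univ + n * M.real univ - ε
      ≤ (m - η) * N.real (Iic A) + (n - η) * M.real (Iic A) := by
    nlinarith [mul_le_mul_of_nonneg_left h1 hn, mul_le_mul_of_nonneg_left h2 hm,
      mul_le_mul_of_nonneg_left h3 hη0.le, mul_le_mul_of_nonneg_left h4 hη0.le]
  have := mul_le_mul_of_nonneg_right key (hg0 x)
  linarith

/-- The event that both summands exceed a high level contributes negligibly to `M * N`. -/
def NegligibleBoth (T : ℝ≥0∞) (g : ℝ → ℝ) (M N : Measure ℝ) : Prop :=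
  ∀ ε : ℝ, 0 < ε → ∃ A, ∀ᶠ x in atTop, bothLarge T M N A x ≤ ε * g x

theorem NegligibleBoth.symm {T : ℝ≥0∞} {g : ℝ → ℝ} {M N : Measure ℝ} [IsFiniteMeasure M]
    [IsFiniteMeasure N] (h : NegligibleBoth T g M N) : NegligibleBoth T g N M := by
  intro ε hε
  obtain ⟨A, hA⟩ := h ε hε
  refine ⟨A, ?_⟩
  simpa only [bothLarge_comm T N M] using hA

/-- The upper counterpart of `AsympGE.conv`, which needs in addition that two large summands
contribute negligibly. -/
theorem AsympLE.conv (T : ℝ≥0∞) {g : ℝ → ℝ} (hg0 : ∀ x, 0 ≤ g x)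
    (hs : ShiftLE g) (M N : Measure ℝ) [IsFiniteMeasure M] [IsFiniteMeasure N]
    (hM0 : M (Iio 0) = 0) (hN0 : N (Iio 0) = 0) {m n : ℝ} (hm : 0 ≤ m) (hn : 0 ≤ n)
    (hM : AsympLE g (fun x => M.real (window T x)) m)
    (hN : AsympLE g (fun x => N.real (window T x)) n)
    (hJ : NegligibleBoth T g M N) :
    AsympLE g (fun x => (M.conv N).real (window T x))
      (m * N.real univ + n * M.real univ) := by
  intro ε hε
  set K := M.real univ + N.real univ + 1 with hK
  have hM1 : 0 ≤ M.real univ := measureReal_nonneg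
  have hN1 : 0 ≤ N.real univ := measureReal_nonneg
  have hK0 : 0 < K := by positivity
  set η := ε / K with hη
  have hη0 : 0 < η := by positivity
  have hηK : η * K = ε := by rw [hη]; field_simp
  obtain ⟨A, hA⟩ := hJ η hη0
  filter_upwards [eventually_ge_atTop (2 * A), hA,
    eventually_conv_restrict_Iic_le T hs M N hN0 hm hM A hη0,
    eventually_conv_restrict_Iic_le T hs N M hM0 hn hN A hη0] with x hx hxJ hx1 hx2
  rw [conv_window_split T M N hx]
  have h3 : M.real (Iic A) ≤ M.real univ := measureReal_mono (subset_univ _)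
  have h4 : N.real (Iic A) ≤ N.real univ := measureReal_mono (subset_univ _)
  have key : (m + η) * N.real (Iic A) + (n + η) * M.real (Iic A) + η
      ≤ m * N.real univ + n * M.real univ + ε := by
    nlinarith [mul_le_mul_of_nonneg_left h3 (add_nonneg hn hη0.le),
      mul_le_mul_of_nonneg_left h4 (add_nonneg hm hη0.le)]
  have := mul_le_mul_of_nonneg_right key (hg0 x)
  linarith

/-- Negligibility passes from `G` to measures whose windows are dominated by those of `G`. -/
theorem NegligibleBoth.of_left {T : ℝ≥0∞} {G M N : Measure ℝ} [IsFiniteMeasure G]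
    [IsFiniteMeasure M] [IsFiniteMeasure N] (hs : ShiftLE fun x => G.real (window T x))
    {m n : ℝ} (hm : 0 ≤ m) (hn : 0 ≤ n)
    (hM : AsympLE (fun x => G.real (window T x)) (fun x => M.real (window T x)) m)
    (hN : AsympLE (fun x => G.real (window T x)) (fun x => N.real (window T x)) n)
    (hJ : NegligibleBoth T (fun x => G.real (window T x)) G N) :
    NegligibleBoth T (fun x => G.real (window T x)) M N := by
  intro ε hε
  set η := ε / (m + n + 2) with hη
  have hη0 : 0 < η := by positivity
  have hηK : η * (m + n + 2) = ε := by rw [hη]; field_simp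
  obtain ⟨A0, hA0⟩ := hJ η hη0
  obtain ⟨A1, hA1⟩ := eventually_atTop.1 (hM 1 one_pos)
  obtain ⟨A2, hA2⟩ := exists_real_window_lt T M hη0
  set A := max A0 (max A1 A2) with hA
  have hAA1 : A1 ≤ A := (le_max_left _ _).trans (le_max_right _ _)
  have hAA2 : A2 ≤ A := (le_max_right _ _).trans (le_max_right _ _)
  refine ⟨max A 0, ?_⟩
  have hNs := hN.shift hn hs (max A 0) 1 one_pos
  filter_upwards [hA0, hNs] with x hx hxN
  have h1 := bothLarge_le T M G N (A := A0) (A' := max A 0) (z := 0) (C := m + 1) le_rfl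
    (by rw [add_zero]; exact (le_max_left _ _).trans (le_max_left _ _)) (by linarith)
    (fun w hw => by
      rw [sub_zero]
      exact hA1 w (hAA1.trans ((le_max_left _ _).trans hw))) x
  rw [sub_zero] at h1
  have h2 := hA2 (max A 0) (hAA2.trans (le_max_left _ _))
  have h3 := hxN (max A 0) ⟨le_max_right _ _, le_rfl⟩
  have h4 : M.real (window T (max A 0)) * N.real (window T (x - max A 0))
      ≤ η * ((n + 1) * G.real (window T x)) :=
    mul_le_mul h2 h3 measureReal_nonneg hη0.le
  have h5 := mul_le_mul_of_nonneg_left hx (show 0 ≤ m + 1 by linarith)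
  have : ε * G.real (window T x) = (η * (m + n + 2)) * G.real (window T x) := by rw [hηK]
  linarith

/-- If `limsup (G * G) / G ≤ 2` then both summands being large is negligible: the configurations
with one small summand already account for `2 G`. -/
theorem negligibleBoth_of_conv_self {T : ℝ≥0∞} {G : Measure ℝ} [IsProbabilityMeasure G]
    (hG0 : G (Iio 0) = 0) (hs : ShiftGE fun x => G.real (window T x))
    (h2 : AsympLE (fun x => G.real (window T x)) (fun x => (G.conv G).real (window T x)) 2) :
    NegligibleBoth T (fun x => G.real (window T x)) G G := by
  intro ε hε
  have hη0 : 0 < ε / 5 := by positivity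
  obtain ⟨A0, hA0⟩ := exists_real_Iic_gt G hη0
  refine ⟨A0, ?_⟩
  filter_upwards [eventually_ge_atTop (2 * A0), h2 _ hη0,
    eventually_le_conv_restrict_Iic T (fun _ => measureReal_nonneg) hs G G hG0
      (asympGE_refl T G) A0 hη0]
    with x hx h3 h4
  rw [conv_window_split T G G hx] at h3
  have h5 := hA0 A0 le_rfl
  have h6 : G.real (Iic A0) ≤ 1 := measureReal_le_one
  rw [probReal_univ] at h5
  have key : 1 - 2 * (ε / 5) ≤ (1 - ε / 5) * G.real (Iic A0) := by nlinarith
  have := mul_le_mul_of_nonneg_right key (measureReal_nonneg (μ := G) (s := window T x))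
  linarith

/-! ### Long-tailed distributions -/

/-- Growth and decay of `G (x + Δ)` are slower than any exponential. -/
theorem LongTailed.exists_exp_bounds {T : ℝ≥0∞} {G : Measure ℝ} (h : LongTailed T G) {δ : ℝ}
    (hδ : 0 < δ) : ∃ x0, (∀ x, x0 ≤ x → 0 < G.real (window T x)) ∧
      ∀ n : ℕ, ∀ x, x0 ≤ x → ∀ t ∈ Icc (0 : ℝ) n,
        Real.exp (-(δ * n)) * G.real (window T x) ≤ G.real (window T (x + t)) ∧
        G.real (window T (x + t)) ≤ Real.exp (δ * n) * G.real (window T x) := by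
  have hε : 0 < 1 - Real.exp (-δ) := by simp [hδ]
  have hexp : 1 + (1 - Real.exp (-δ)) ≤ Real.exp δ := by
    have h1 := Real.exp_pos δ
    have h2 := Real.exp_pos (-δ)
    have h3 : Real.exp δ * Real.exp (-δ) = 1 := by rw [← Real.exp_add]; simp
    nlinarith [sq_nonneg (Real.exp δ - 1)]
  obtain ⟨x0, hx0⟩ := eventually_atTop.1
    (h.eventually_pos.and (Metric.tendstoUniformlyOn_iff.1 h.tendsto_ratio _ hε))
  have one : ∀ x, x0 ≤ x → ∀ t ∈ Icc (0 : ℝ) 1,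
      Real.exp (-δ) * G.real (window T x) ≤ G.real (window T (x + t)) ∧
      G.real (window T (x + t)) ≤ Real.exp δ * G.real (window T x) := by
    intro x hx t ht
    obtain ⟨hpos, hr⟩ := hx0 x hx
    have := hr t ht
    rw [Real.dist_eq, abs_lt] at this
    rw [← le_div_iff₀ hpos, ← div_le_iff₀ hpos]
    constructor <;> linarith
  refine ⟨x0, fun x hx => (hx0 x hx).1, fun n => ?_⟩
  induction n with
  | zero =>
    intro x _ t ht
    have : t = 0 := le_antisymm (by simpa using ht.2) ht.1
    simp [this]
  | succ n ih =>
    intro x hx t ht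
    have hn : (0 : ℝ) ≤ n := Nat.cast_nonneg n
    have hs : min t 1 ∈ Icc (0 : ℝ) 1 := ⟨le_min ht.1 zero_le_one, min_le_right _ _⟩
    have hu : t - min t 1 ∈ Icc (0 : ℝ) n := by
      refine ⟨by linarith [min_le_left t 1], ?_⟩
      have := ht.2
      push_cast at this
      rcases le_total t 1 with h1 | h1
      · rw [min_eq_left h1]; linarith
      · rw [min_eq_right h1]; linarith
    obtain ⟨a1, a2⟩ := one x hx _ hs
    obtain ⟨b1, b2⟩ := ih (x + min t 1) (by linarith [hs.1]) _ hu
    rw [show x + min t 1 + (t - min t 1) = x + t by ring] at b1 b2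
    constructor
    · calc _ = Real.exp (-(δ * n)) * (Real.exp (-δ) * G.real (window T x)) := by
            rw [← mul_assoc, ← Real.exp_add]; congr 2; push_cast; ring
        _ ≤ _ := (mul_le_mul_of_nonneg_left a1 (Real.exp_pos _).le).trans b1
    · calc _ ≤ Real.exp (δ * n) * (Real.exp δ * G.real (window T x)) :=
            b2.trans (mul_le_mul_of_nonneg_left a2 (Real.exp_pos _).le)
        _ = _ := by
            rw [← mul_assoc, ← Real.exp_add]; congr 2; push_cast; ring

theorem LongTailed.shift {T : ℝ≥0∞} {G : Measure ℝ} (h : LongTailed T G) :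
    ShiftGE (fun x => G.real (window T x)) ∧ ShiftLE (fun x => G.real (window T x)) := by
  suffices H : ∀ A ε : ℝ, 0 < ε → ∀ᶠ x in atTop, ∀ y ∈ Icc 0 A,
      (1 - ε) * G.real (window T x) ≤ G.real (window T (x - y)) ∧
      G.real (window T (x - y)) ≤ (1 + ε) * G.real (window T x) from
    ⟨fun A ε hε => (H A ε hε).mono fun x hx y hy => (hx y hy).1,
     fun A ε hε => (H A ε hε).mono fun x hx y hy => (hx y hy).2⟩
  intro A ε hε
  obtain ⟨n, hn⟩ := exists_nat_ge (max A 1)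
  have hn1 : (1 : ℝ) ≤ n := (le_max_right _ _).trans hn
  have hn0 : (0 : ℝ) < n := by linarith
  have hl : 0 < Real.log (1 + ε) := Real.log_pos (by linarith)
  obtain ⟨x0, hpos, hx0⟩ := h.exists_exp_bounds (δ := Real.log (1 + ε) / n) (by positivity)
  have e1 : Real.log (1 + ε) / n * n = Real.log (1 + ε) := by field_simp
  filter_upwards [eventually_ge_atTop (x0 + A)] with x hx y hy
  obtain ⟨h1, h2⟩ := hx0 n (x - y) (by linarith [hy.2]) y
    ⟨hy.1, hy.2.trans ((le_max_left _ _).trans hn)⟩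
  rw [e1, sub_add_cancel] at h1 h2
  rw [Real.exp_neg, Real.exp_log (by linarith)] at h1
  rw [Real.exp_log (by linarith)] at h2
  have hε1 : 0 < 1 + ε := by linarith
  rw [inv_mul_le_iff₀ hε1] at h1
  refine ⟨?_, h1⟩
  have h3 := measureReal_nonneg (μ := G) (s := window T x)
  have h4 := measureReal_nonneg (μ := G) (s := window T (x - y))
  rcases le_or_gt 1 ε with h5 | h5
  · nlinarith
  · have := mul_le_mul_of_nonneg_left h2 (show 0 ≤ 1 - ε by linarith)
    nlinarith [mul_nonneg (sq_nonneg ε) h4]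

/-! ### Convolution powers -/

instance isFiniteMeasure_convPow (G : Measure ℝ) [IsFiniteMeasure G] (n : ℕ) :
    IsFiniteMeasure (convPow G n) := by
  induction n with
  | zero => rw [convPow]; infer_instance
  | succ n ih => rw [convPow]; infer_instance

instance isProbabilityMeasure_convPow (G : Measure ℝ) [IsProbabilityMeasure G] (n : ℕ) :
    IsProbabilityMeasure (convPow G n) := by
  induction n with
  | zero => rw [convPow]; infer_instance
  | succ n ih => rw [convPow]; infer_instance

theorem convPow_Iio_zero {G : Measure ℝ} [IsFiniteMeasure G] (hG : G (Iio 0) = 0) (n : ℕ) :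
    convPow G n (Iio 0) = 0 := by
  induction n with
  | zero => simp [convPow]
  | succ n ih => exact conv_Iio_zero ih hG

theorem convPow_smul (c : ℝ≥0∞) (G : Measure ℝ) [IsFiniteMeasure G] (n : ℕ) :
    convPow (c • G) n = c ^ n • convPow G n := by
  induction n with
  | zero => simp [convPow]
  | succ n ih =>
    rw [convPow, convPow, ih, Measure.conv_smul_left, Measure.conv_smul_right, smul_smul, pow_succ]

theorem convPow_two (G : Measure ℝ) [IsFiniteMeasure G] : convPow G 2 = G.conv G := by
  simp [convPow]

theorem AsympGE.convPow {T : ℝ≥0∞} {G : Measure ℝ} [IsProbabilityMeasure G]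
    (hG0 : G (Iio 0) = 0) (hs : ShiftGE fun x => G.real (window T x)) (n : ℕ) :
    AsympGE (fun x => G.real (window T x))
      (fun x => (LocalSubexp.convPow G n).real (window T x)) n := by
  induction n with
  | zero =>
    simpa using asympGE_zero (fun _ => measureReal_nonneg) (fun _ => measureReal_nonneg)
  | succ n ih =>
    have := ih.conv T (fun _ => measureReal_nonneg) hs _ G (convPow_Iio_zero hG0 n) hG0
      (Nat.cast_nonneg n) zero_le_one (asympGE_refl T G)
    simpa [LocalSubexp.convPow] using this

theorem AsympLE.convPow {T : ℝ≥0∞} {G : Measure ℝ} [IsProbabilityMeasure G]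
    (hG0 : G (Iio 0) = 0) (hs : ShiftLE fun x => G.real (window T x))
    (hJ : NegligibleBoth T (fun x => G.real (window T x)) G G) (n : ℕ) :
    AsympLE (fun x => G.real (window T x))
      (fun x => (LocalSubexp.convPow G n).real (window T x)) n := by
  induction n with
  | zero =>
    intro ε hε
    filter_upwards [eventually_ge_atTop 0] with x hx
    have : (0 : ℝ) ∉ window T x := fun h => absurd h.1 (not_lt.2 hx)
    have : (LocalSubexp.convPow G 0).real (window T x) = 0 := by
      simp [LocalSubexp.convPow, measureReal_def, measurableSet_window, this]
    rw [this]
    have := measureReal_nonneg (μ := G) (s := window T x)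
    simp only [Nat.cast_zero, zero_add]
    positivity
  | succ n ih =>
    have := ih.conv T (fun _ => measureReal_nonneg) hs _ G (convPow_Iio_zero hG0 n) hG0
      (Nat.cast_nonneg n) zero_le_one (asympLE_refl T G)
      (NegligibleBoth.of_left hs (Nat.cast_nonneg n) zero_le_one ih (asympLE_refl T G) hJ)
    simpa [LocalSubexp.convPow] using this

theorem Subexponential.asympLE_conv_self {T : ℝ≥0∞} {G : Measure ℝ} (h : Subexponential T G) :
    AsympLE (fun x => G.real (window T x)) (fun x => (G.conv G).real (window T x)) 2 := by
  refine ((tendsto_div_iff_asymp (m := 2) h.longTailed.eventually_pos).1 ?_).2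
  have := h.conv_self.const_mul 2
  simp only [mul_one] at this
  refine this.congr fun x => ?_
  rw [← mul_div_assoc, mul_div_mul_left _ _ two_ne_zero]

theorem Subexponential.negligibleBoth {T : ℝ≥0∞} {G : Measure ℝ} (h : Subexponential T G) :
    NegligibleBoth T (fun x => G.real (window T x)) G G :=
  have := h.longTailed.isProb
  negligibleBoth_of_conv_self h.nonneg h.longTailed.shift.1 h.asympLE_conv_self

/-- A geometric bound for convolution powers, uniform in `x`. The constant `K` need not be close
to `1`, because Poisson weights decay faster than any geometric sequence. -/
theorem Subexponential.exists_convPow_le {T : ℝ≥0∞} {G : Measure ℝ} (h : Subexponential T G) :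
    ∃ K x0 : ℝ, ∀ (n : ℕ) (x : ℝ), x0 ≤ x →
      (convPow G n).real (window T x) ≤ K ^ n * G.real (window T x) := by
  have := h.longTailed.isProb
  set g : ℝ → ℝ := fun x => G.real (window T x) with hg
  have hg0 : ∀ x, 0 ≤ g x := fun _ => measureReal_nonneg
  obtain ⟨x0, hpos, hexp⟩ := h.longTailed.exists_exp_bounds one_pos
  obtain ⟨x1, hx1⟩ := eventually_atTop.1 (h.asympLE_conv_self 1 one_pos)
  set A := max x0 (max x1 0) with hA
  have hAx0 : x0 ≤ A := le_max_left _ _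
  have hAx1 : x1 ≤ A := (le_max_left _ _).trans (le_max_right _ _)
  have hA0 : 0 ≤ A := (le_max_right _ _).trans (le_max_right _ _)
  obtain ⟨k, hk⟩ := exists_nat_ge A
  set L := Real.exp k with hL
  have hL1 : 0 < L := Real.exp_pos _
  have shift : ∀ x, A ≤ x → ∀ t ∈ Icc 0 A, g x ≤ L * g (x + t) := by
    intro x hx t ht
    have := (hexp k x (hAx0.trans hx) t ⟨ht.1, ht.2.trans hk⟩).1
    rwa [one_mul, Real.exp_neg, inv_mul_le_iff₀ hL1] at this
  have hgA : 0 < g A := hpos A hAx0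
  set K := 3 + 3 * L + L / g A with hK
  have hLg : 0 < L / g A := by positivity
  have hK1 : 1 ≤ K := by linarith
  refine ⟨K, A, fun n => ?_⟩
  induction n with
  | zero =>
    intro x hx
    have : (0 : ℝ) ∉ window T x := fun h => absurd h.1 (not_lt.2 (hA0.trans hx))
    have : (convPow G 0).real (window T x) = 0 := by
      simp [convPow, measureReal_def, measurableSet_window, this]
    rw [this, pow_zero, one_mul]
    exact hg0 x
  | succ n ih =>
    intro x hx
    have hKn : 1 ≤ K ^ n := one_le_pow₀ hK1
    -- Beyond `2 A` the sum is split at the level `A`; on `[A, 2 A]` the trivial bound `1` suffices,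
    -- since `g` is bounded below there. The latter gives the term `L / g A` of `K`.
    rcases le_or_gt (2 * A) x with hx2 | hx2
    · have s : ∀ z ∈ Icc 0 A, g (x - z) ≤ L * g x := by
        intro z hz
        have := shift (x - z) (by linarith [hz.2]) z hz
        rwa [sub_add_cancel] at this
      rw [convPow, conv_window_split T _ G hx2]
      have t1 : ((convPow G n).conv (G.restrict (Iic A))).real (window T x)
          ≤ K ^ n * (L * g x) * G.real (Iic A) := by
        refine conv_restrict_le_mul T _ G measurableSet_Iic ?_
        filter_upwards [ae_nonneg h.nonneg] with y hy hyA
        refine (ih (x - y) (by linarith [show y ≤ A from hyA])).trans ?_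
        exact mul_le_mul_of_nonneg_left (s y ⟨hy, hyA⟩) (by linarith)
      have t2 : (G.conv ((convPow G n).restrict (Iic A))).real (window T x)
          ≤ (L * g x) * (convPow G n).real (Iic A) := by
        refine conv_restrict_le_mul T G _ measurableSet_Iic ?_
        filter_upwards [ae_nonneg (convPow_Iio_zero h.nonneg n)] with y hy hyA
        exact s y ⟨hy, hyA⟩
      have t3 : bothLarge T (convPow G n) G A x ≤ K ^ n * bothLarge T G G A x
          + (convPow G n).real (window T A) * g (x - A) := by
        have := bothLarge_le T (convPow G n) G G (A := A) (A' := A) (z := 0) (C := K ^ n) le_rfl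
          (by simp) (by linarith) (fun w hw => by rw [sub_zero]; exact ih w hw) x
        rwa [sub_zero] at this
      have t4 : bothLarge T G G A x ≤ 3 * g x := by
        have h1 := hx1 x (by linarith)
        simp only [conv_window_split T G G hx2] at h1
        have h2 : 0 ≤ (G.conv (G.restrict (Iic A))).real (window T x) := measureReal_nonneg
        linarith
      have t5 : (convPow G n).real (window T A) * g (x - A) ≤ 1 * (L * g x) :=
        mul_le_mul measureReal_le_one (s A ⟨hA0, le_rfl⟩) (hg0 _) zero_le_one
      have hLx : 0 ≤ L * g x := mul_nonneg hL1.le (hg0 x)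
      have t1' : K ^ n * (L * g x) * G.real (Iic A) ≤ K ^ n * (L * g x) :=
        mul_le_of_le_one_right (by positivity) measureReal_le_one
      have t2' : (L * g x) * (convPow G n).real (Iic A) ≤ K ^ n * (L * g x) :=
        (mul_le_of_le_one_right hLx measureReal_le_one).trans (le_mul_of_one_le_left hLx hKn)
      have t5' : 1 * (L * g x) ≤ K ^ n * (L * g x) :=
        mul_le_mul_of_nonneg_right hKn hLx
      have t4' := mul_le_mul_of_nonneg_left t4 (show 0 ≤ K ^ n by linarith)
      calc _ ≤ K ^ n * (3 + 3 * L) * g x := by linarith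
        _ ≤ K ^ n * K * g x := by
            refine mul_le_mul_of_nonneg_right ?_ (hg0 x)
            exact mul_le_mul_of_nonneg_left (by linarith) (by linarith)
        _ = _ := by rw [pow_succ]
    · have h1 := shift A le_rfl (x - A) ⟨by linarith, by linarith⟩
      rw [add_sub_cancel] at h1
      calc (convPow G (n + 1)).real (window T x) ≤ 1 := measureReal_le_one
        _ ≤ L / g A * g x := by
            rw [div_mul_eq_mul_div, le_div_iff₀ hgA, one_mul]; exact h1
        _ ≤ K ^ (n + 1) * g x := by
            refine mul_le_mul_of_nonneg_right ?_ (hg0 x)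
            rw [pow_succ]
            calc L / g A ≤ 1 * K := by linarith
              _ ≤ _ := mul_le_mul_of_nonneg_right hKn (by linarith)

/-! ### Compound Poisson laws -/

/-- The compound Poisson law with finite jump measure `ρ`: the law of a sum of a Poisson number
of independent jumps, which is `exp (-ρ(ℝ)) * ∑ ρ^{*n} / n!`. -/
noncomputable def compoundPoisson (ρ : Measure ℝ) : Measure ℝ :=
  Measure.sum fun n : ℕ => ENNReal.ofReal (Real.exp (-ρ.real univ) / n.factorial) • convPow ρ n

/-- The weights of the Poisson distribution of mean `m`. -/
noncomputable def poissonWeight (m : ℝ) (n : ℕ) : ℝ := Real.exp (-m) * m ^ n / n.factorial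

theorem poissonWeight_nonneg {m : ℝ} (hm : 0 ≤ m) (n : ℕ) : 0 ≤ poissonWeight m n := by
  unfold poissonWeight; positivity

theorem hasSum_poissonWeight_mul_pow (m K : ℝ) :
    HasSum (fun n => poissonWeight m n * K ^ n) (Real.exp (m * K - m)) := by
  have h := (NormedSpace.expSeries_div_hasSum_exp (𝔸 := ℝ) (m * K)).mul_left (Real.exp (-m))
  rw [← Real.exp_eq_exp_ℝ, ← Real.exp_add] at h
  have e : (fun n => poissonWeight m n * K ^ n)
      = fun n => Real.exp (-m) * ((m * K) ^ n / n.factorial) := by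
    funext n
    rw [poissonWeight, mul_pow]; ring
  rw [e, show m * K - m = -m + m * K by ring]
  exact h

theorem hasSum_poissonWeight (m : ℝ) : HasSum (poissonWeight m) 1 := by
  simpa using hasSum_poissonWeight_mul_pow m 1

theorem hasSum_poissonWeight_mul_nat (m : ℝ) :
    HasSum (fun n : ℕ => poissonWeight m n * n) m := by
  rw [← hasSum_nat_add_iff' 1]
  simp only [Finset.range_one, Finset.sum_singleton, Nat.cast_zero, mul_zero, sub_zero]
  have e : (fun n : ℕ => poissonWeight m (n + 1) * ((n + 1 : ℕ) : ℝ))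
      = fun n => m * poissonWeight m n := by
    funext n
    rw [poissonWeight, poissonWeight, Nat.factorial_succ, pow_succ]
    have : (n.factorial : ℝ) ≠ 0 := by positivity
    push_cast
    field_simp
  rw [e]
  simpa using (hasSum_poissonWeight m).mul_left m

theorem compoundPoisson_smul {m : ℝ} (hm : 0 ≤ m) (G : Measure ℝ) [IsProbabilityMeasure G] :
    compoundPoisson (ENNReal.ofReal m • G)
      = Measure.sum fun n => ENNReal.ofReal (poissonWeight m n) • convPow G n := by
  rw [compoundPoisson]
  congr 1
  funext n
  rw [convPow_smul, smul_smul, ← ENNReal.ofReal_pow hm, ← ENNReal.ofReal_mul (by positivity)]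
  congr 2
  rw [measureReal_ennreal_smul_apply, ENNReal.toReal_ofReal hm, probReal_univ, mul_one,
    poissonWeight]
  ring

theorem hasSum_conv_compoundPoisson (T : ℝ≥0∞) (M : Measure ℝ) [IsFiniteMeasure M] {m : ℝ}
    (hm : 0 ≤ m) (G : Measure ℝ) [IsProbabilityMeasure G]
    [IsFiniteMeasure (compoundPoisson (ENNReal.ofReal m • G))] (x : ℝ) :
    HasSum (fun n => poissonWeight m n * (M.conv (convPow G n)).real (window T x))
      ((M.conv (compoundPoisson (ENNReal.ofReal m • G))).real (window T x)) := by
  have key : (M.conv (compoundPoisson (ENNReal.ofReal m • G))) (window T x)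
      = ∑' n, ENNReal.ofReal (poissonWeight m n) * (M.conv (convPow G n)) (window T x) := by
    rw [Measure.conv_comm, conv_window_eq_lintegral, compoundPoisson_smul hm]
    simp_rw [Measure.sum_apply _ (measurableSet_window T _), Measure.smul_apply, smul_eq_mul]
    rw [lintegral_tsum fun n => ((measurable_measure_window T _ x).const_mul _).aemeasurable]
    refine tsum_congr fun n => ?_
    rw [lintegral_const_mul _ (measurable_measure_window T _ x), Measure.conv_comm,
      conv_window_eq_lintegral]
  have hfin : ∑' n, ENNReal.ofReal (poissonWeight m n) * (M.conv (convPow G n)) (window T x)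
      ≠ ∞ := by
    rw [← key]; exact measure_ne_top _ _
  have := ENNReal.hasSum_toReal hfin
  rw [← ENNReal.tsum_toReal_eq fun n => ENNReal.ne_top_of_tsum_ne_top hfin n] at this
  simpa [measureReal_def, key, ENNReal.toReal_mul,
    ENNReal.toReal_ofReal (poissonWeight_nonneg hm _),
    ENNReal.tsum_toReal_eq fun n => ENNReal.ne_top_of_tsum_ne_top hfin n] using this

/-- The compound Poisson law with subexponential jumps has `Δ`-tails `m * G (x + Δ)`. -/
theorem Subexponential.tendsto_compoundPoisson {T : ℝ≥0∞} {G : Measure ℝ}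
    (h : Subexponential T G) [IsProbabilityMeasure G] {m : ℝ} (hm : 0 ≤ m)
    [IsFiniteMeasure (compoundPoisson (ENNReal.ofReal m • G))] :
    Tendsto (fun x => (compoundPoisson (ENNReal.ofReal m • G)).real (window T x)
      / G.real (window T x)) atTop (𝓝 m) := by
  obtain ⟨K, x0, hK⟩ := h.exists_convPow_le
  have hsum : ∀ x, (compoundPoisson (ENNReal.ofReal m • G)).real (window T x)
      / G.real (window T x)
      = ∑' n, poissonWeight m n * ((convPow G n).real (window T x) / G.real (window T x)) := by
    intro x
    have := (hasSum_conv_compoundPoisson T (Measure.dirac 0) hm G x).div_const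
      (G.real (window T x))
    simp only [Measure.dirac_zero_conv, mul_div_assoc] at this
    exact this.tsum_eq.symm
  simp_rw [hsum]
  have hmean := (hasSum_poissonWeight_mul_nat m).tsum_eq
  refine Eq.subst (motive := fun c => Tendsto _ _ (𝓝 c)) hmean ?_
  refine tendsto_tsum_of_dominated_convergence (hasSum_poissonWeight_mul_pow m K).summable ?_ ?_
  · intro n
    refine Tendsto.const_mul _ ((tendsto_div_iff_asymp h.longTailed.eventually_pos).2 ⟨?_, ?_⟩)
    · exact AsympGE.convPow h.nonneg h.longTailed.shift.1 n
    · exact AsympLE.convPow h.nonneg h.longTailed.shift.2 h.negligibleBoth n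
  · filter_upwards [eventually_ge_atTop x0, h.longTailed.eventually_pos] with x hx hpos n
    have h0 : 0 ≤ (convPow G n).real (window T x) / G.real (window T x) := by positivity
    rw [Real.norm_of_nonneg (mul_nonneg (poissonWeight_nonneg hm n) h0)]
    refine mul_le_mul_of_nonneg_left ?_ (poissonWeight_nonneg hm n)
    rw [div_le_iff₀ hpos]
    exact hK n x hx

/-- Convolving with a law that has a finite exponential moment does not change the `Δ`-tails. -/
theorem Subexponential.tendsto_conv {T : ℝ≥0∞} {G : Measure ℝ}
    (h : Subexponential T G) (M N : Measure ℝ) [IsProbabilityMeasure M] [IsProbabilityMeasure N]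
    (hM0 : M (Iio 0) = 0) (hN0 : N (Iio 0) = 0)
    (hM : ∫⁻ y, ENNReal.ofReal (Real.exp (2 * y)) ∂M ≠ ∞) {m : ℝ} (hm : 0 ≤ m)
    (hN : Tendsto (fun x => N.real (window T x) / G.real (window T x)) atTop (𝓝 m)) :
    Tendsto (fun x => (M.conv N).real (window T x) / G.real (window T x)) atTop (𝓝 m) := by
  have := h.longTailed.isProb
  obtain ⟨hs1, hs2⟩ := h.longTailed.shift
  have hpos := h.longTailed.eventually_pos
  obtain ⟨hN1, hN2⟩ := (tendsto_div_iff_asymp hpos).1 hN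
  have hM1 : AsympGE (fun x => G.real (window T x)) (fun x => M.real (window T x)) 0 :=
    asympGE_zero (fun _ => measureReal_nonneg) (fun _ => measureReal_nonneg)
  have hM2 : AsympLE (fun x => G.real (window T x)) (fun x => M.real (window T x)) 0 := by
    set C := (∫⁻ y, ENNReal.ofReal (Real.exp (2 * y)) ∂M).toReal with hC
    have markov : ∀ x, M.real (window T x) ≤ C * Real.exp (-(2 * x)) := by
      intro x
      have h1 := mul_meas_ge_le_lintegral (μ := M) (f := fun y => ENNReal.ofReal (Real.exp (2 * y)))
        (by fun_prop) (ENNReal.ofReal (Real.exp (2 * x)))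
      have h2 : M (window T x) ≤ M {y | ENNReal.ofReal (Real.exp (2 * x))
          ≤ ENNReal.ofReal (Real.exp (2 * y))} := by
        refine measure_mono fun y hy => ENNReal.ofReal_le_ofReal (Real.exp_le_exp.2 ?_)
        linarith [hy.1]
      have h3 := ENNReal.toReal_mono hM ((mul_le_mul_right h2 _).trans h1)
      rw [ENNReal.toReal_mul, ENNReal.toReal_ofReal (Real.exp_pos _).le] at h3
      rw [Real.exp_neg, ← div_eq_mul_inv, le_div_iff₀ (Real.exp_pos _), mul_comm]
      exact h3
    obtain ⟨x0, hp, hexp⟩ := h.longTailed.exists_exp_bounds one_pos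
    intro ε hε
    -- `G (x + Δ)` decays at most like `exp (-x)`.
    have hdecay : ∀ x, x0 ≤ x → Real.exp (x0 - x - 1) * G.real (window T x0)
        ≤ G.real (window T x) := by
      intro x hx
      have h1 := (hexp ⌈x - x0⌉₊ x0 le_rfl (x - x0) ⟨by linarith, Nat.le_ceil _⟩).1
      rw [add_sub_cancel] at h1
      refine le_trans (mul_le_mul_of_nonneg_right (Real.exp_le_exp.2 ?_) measureReal_nonneg) h1
      have := Nat.ceil_lt_add_one (show 0 ≤ x - x0 by linarith)
      linarith
    have hlim : Tendsto (fun x : ℝ => C * Real.exp (-x)) atTop (𝓝 0) := by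
      simpa using (Real.tendsto_exp_neg_atTop_nhds_zero).const_mul C
    have hc : 0 < ε * (Real.exp (x0 - 1) * G.real (window T x0)) :=
      mul_pos hε (mul_pos (Real.exp_pos _) (hp x0 le_rfl))
    filter_upwards [eventually_ge_atTop x0, hlim.eventually_le_const hc] with x hx hx2
    calc M.real (window T x) ≤ C * Real.exp (-(2 * x)) := markov x
      _ = (C * Real.exp (-x)) * Real.exp (-x) := by
          rw [mul_assoc, ← Real.exp_add]; congr 2; ring
      _ ≤ ε * (Real.exp (x0 - 1) * G.real (window T x0)) * Real.exp (-x) :=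
          mul_le_mul_of_nonneg_right hx2 (Real.exp_pos _).le
      _ = ε * (Real.exp (x0 - x - 1) * G.real (window T x0)) := by
          rw [show x0 - x - 1 = (x0 - 1) + -x by ring, Real.exp_add]; ring
      _ ≤ (0 + ε) * G.real (window T x) := by
          rw [zero_add]; exact mul_le_mul_of_nonneg_left (hdecay x hx) hε.le
  have hJ : NegligibleBoth T (fun x => G.real (window T x)) M N := by
    refine NegligibleBoth.of_left hs2 le_rfl hm hM2 hN2 (NegligibleBoth.symm ?_)
    exact NegligibleBoth.of_left hs2 hm zero_le_one hN2 (asympLE_refl T G) h.negligibleBoth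
  refine (tendsto_div_iff_asymp hpos).2 ⟨?_, ?_⟩
  · simpa using hM1.conv T (fun _ => measureReal_nonneg) hs1 M N hM0 hN0 le_rfl hm hN1
  · simpa using hM2.conv T (fun _ => measureReal_nonneg) hs2 M N hM0 hN0 le_rfl hm hN2 hJ

/-! ### From tail equivalence to subexponentiality -/

/-- Every term `M * G^{*n}` of the Poisson mixture contributes asymptotically at least `n G`. If
the mixture itself contributes no more than the mean of the Poisson weights, then none of these
lower bounds can be exceeded; this is the case of the term `n = 2`. -/
theorem asympLE_conv_conv_self {T : ℝ≥0∞} {G M : Measure ℝ} [IsProbabilityMeasure G]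
    [IsProbabilityMeasure M] (hG0 : G (Iio 0) = 0) (hM0 : M (Iio 0) = 0)
    (hs : ShiftGE fun x => G.real (window T x)) {m : ℝ} (hm : 0 < m)
    [IsFiniteMeasure (compoundPoisson (ENNReal.ofReal m • G))]
    (hF : AsympLE (fun x => G.real (window T x))
      (fun x => (M.conv (compoundPoisson (ENNReal.ofReal m • G))).real (window T x)) m) :
    AsympLE (fun x => G.real (window T x))
      (fun x => (M.conv (G.conv G)).real (window T x)) 2 := by
  have hlow : ∀ n, AsympGE (fun x => G.real (window T x))
      (fun x => (M.conv (convPow G n)).real (window T x)) n := by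
    intro n
    have h0 : AsympGE (fun x => G.real (window T x)) (fun x => M.real (window T x)) 0 :=
      asympGE_zero (fun _ => measureReal_nonneg) (fun _ => measureReal_nonneg)
    have := h0.conv T (fun _ => measureReal_nonneg) hs M (convPow G n) hM0
      (convPow_Iio_zero hG0 n) le_rfl (Nat.cast_nonneg n) (AsympGE.convPow hG0 hs n)
    simpa using this
  intro ε hε
  have hp2 : 0 < poissonWeight m 2 := by unfold poissonWeight; positivity
  set η := ε * poissonWeight m 2 / 3 with hη
  have hη0 : 0 < η := by positivity
  obtain ⟨N, hN3, hN⟩ : ∃ N, 3 ≤ N ∧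
      m - η ≤ ∑ n ∈ Finset.range N, poissonWeight m n * n := by
    have h1 := (hasSum_poissonWeight_mul_nat m).tendsto_sum_nat.eventually_const_le
      (show m - η < m by linarith)
    exact ((eventually_ge_atTop 3).and h1).exists
  have hev : ∀ᶠ x in atTop, ∀ n ∈ Finset.range N, ((n : ℝ) - η) * G.real (window T x)
      ≤ (M.conv (convPow G n)).real (window T x) :=
    (Filter.eventually_all_finset _).2 fun n _ => hlow n η hη0
  filter_upwards [hev, hF η hη0] with x hx hFx
  set g := G.real (window T x) with hg
  have hg0 : 0 ≤ g := measureReal_nonneg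
  set a : ℕ → ℝ := fun n => (M.conv (convPow G n)).real (window T x) with ha
  have hpart : ∑ n ∈ Finset.range N, poissonWeight m n * a n
      ≤ (M.conv (compoundPoisson (ENNReal.ofReal m • G))).real (window T x) :=
    sum_le_hasSum _ (fun n _ => mul_nonneg (poissonWeight_nonneg hm.le n) measureReal_nonneg)
      (hasSum_conv_compoundPoisson T M hm.le G x)
  have hone : ∑ n ∈ Finset.range N, poissonWeight m n ≤ 1 :=
    sum_le_hasSum _ (fun n _ => poissonWeight_nonneg hm.le n) (hasSum_poissonWeight m)
  -- All the differences `a n - (n - η) g` are nonnegative, so the one with `n = 2` is at most their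
  -- weighted sum, which is small because the lower bounds already add up to nearly `m g`.
  have hsingle : poissonWeight m 2 * (a 2 - ((2 : ℕ) - η) * g)
      ≤ ∑ n ∈ Finset.range N, poissonWeight m n * (a n - ((n : ℝ) - η) * g) :=
    Finset.single_le_sum (f := fun n : ℕ => poissonWeight m n * (a n - ((n : ℝ) - η) * g))
      (fun n hn => mul_nonneg (poissonWeight_nonneg hm.le n) (sub_nonneg.2 (hx n hn)))
      (Finset.mem_range.2 hN3)
  have hexpand : ∑ n ∈ Finset.range N, poissonWeight m n * (a n - ((n : ℝ) - η) * g)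
      = ∑ n ∈ Finset.range N, poissonWeight m n * a n
        - (∑ n ∈ Finset.range N, poissonWeight m n * n) * g
        + η * (∑ n ∈ Finset.range N, poissonWeight m n) * g := by
    rw [Finset.sum_mul, Finset.mul_sum, Finset.sum_mul, ← Finset.sum_sub_distrib,
      ← Finset.sum_add_distrib]
    exact Finset.sum_congr rfl fun n _ => by ring
  have h3 : poissonWeight m 2 * (a 2 - (2 - η) * g) ≤ 3 * η * g := by
    have h4 := mul_le_mul_of_nonneg_right hN hg0
    have h5 := mul_le_mul_of_nonneg_right (mul_le_mul_of_nonneg_left hone hη0.le) hg0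
    push_cast at hsingle
    linarith
  have h6 : 3 * η * g = poissonWeight m 2 * (ε * g) := by rw [hη]; ring
  rw [h6] at h3
  have h7 := le_of_mul_le_mul_left h3 hp2
  have h8 : a 2 = (M.conv (G.conv G)).real (window T x) := by rw [ha]; simp only [convPow_two]
  rw [← h8]
  nlinarith [mul_nonneg hη0.le hg0]

/-- A long-tailed `G` absorbs the bounded part of the smoothing factor `M`: an upper bound for
`M * G * G` makes the event of two large summands negligible for `G * G`. -/
theorem LongTailed.negligibleBoth_of_conv {T : ℝ≥0∞} {G M : Measure ℝ} (h : LongTailed T G)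
    [IsProbabilityMeasure M] (hG0 : G (Iio 0) = 0) (hM0 : M (Iio 0) = 0)
    (h2 : haveI := h.isProb; AsympLE (fun x => G.real (window T x))
      (fun x => (M.conv (G.conv G)).real (window T x)) 2) :
    NegligibleBoth T (fun x => G.real (window T x)) G G := by
  have := h.isProb
  obtain ⟨hs1, hs2⟩ := h.shift
  intro ε hε
  set η := min (ε / 20) (1 / 5) with hη
  have hη0 : 0 < η := lt_min (by positivity) (by norm_num)
  have hη1 : η ≤ ε / 20 := min_le_left _ _
  have hη2 : η ≤ 1 / 5 := min_le_right _ _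
  obtain ⟨B0, hB0⟩ := exists_real_Iic_gt M hη0
  set B := max B0 0
  have hB := hB0 B (le_max_left _ _)
  have hBnn : 0 ≤ B := le_max_right _ _
  obtain ⟨A, hA0⟩ := exists_real_Iic_gt G hη0
  have hA := hA0 A le_rfl
  rw [probReal_univ] at hA hB
  obtain ⟨A1, hA1⟩ := eventually_atTop.1 (hs1 B (1 / 2) (by norm_num))
  obtain ⟨A2, hA2⟩ := exists_real_window_lt T G hη0
  set A' := max (max (A + B) 0) (max A1 A2)
  have hA'1 : A1 ≤ A' := (le_max_left _ _).trans (le_max_right _ _)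
  have hA'2 : A2 ≤ A' := (le_max_right _ _).trans (le_max_right _ _)
  have hA'3 : A + B ≤ A' := (le_max_left _ _).trans (le_max_left _ _)
  have hA'4 : 0 ≤ A' := (le_max_right _ _).trans (le_max_left _ _)
  have hlow : AsympGE (fun x => G.real (window T x))
      (fun x => (G.conv (G.restrict (Iic A))).real (window T x)) (G.real (Iic A)) := by
    intro δ hδ
    filter_upwards [eventually_le_conv_restrict_Iic T (fun _ => measureReal_nonneg) hs1 G G hG0
      (asympGE_refl T G) A hδ] with x hx
    refine le_trans ?_ hx
    have h3 : G.real (Iic A) ≤ 1 := measureReal_le_one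
    have h4 := measureReal_nonneg (μ := G) (s := window T x)
    rw [mul_right_comm]
    exact mul_le_mul_of_nonneg_right (by nlinarith) h4
  refine ⟨A', ?_⟩
  filter_upwards [h2 η hη0, hlow.shift (fun _ => measureReal_nonneg)
    (fun _ => measureReal_nonneg) hs1 B η hη0,
    (asympLE_refl T G).shift zero_le_one hs2 A' 1 one_pos,
    eventually_ge_atTop (2 * A + B)] with x hx2 hxlow hxs hxA
  set g := G.real (window T x) with hg
  have hg0 : 0 ≤ g := measureReal_nonneg
  set c := (2 - 5 * η) * g + bothLarge T G G A' x / 2 with hc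
  have hJ0 := bothLarge_nonneg T G G A' x
  have hc0 : 0 ≤ c := by
    have : 0 ≤ (2 - 5 * η) * g := mul_nonneg (by linarith) hg0
    rw [hc]; linarith
  -- For a bounded shift `z` the mass of `G * G` near `x - z` controls both contributions at `x`.
  have hcle : ∀ z ∈ Icc 0 B, c ≤ (G.conv G).real (window T (x - z)) := by
    intro z hz
    rw [conv_window_split T G G (A := A) (by linarith [hz.2])]
    have h3 := hxlow z hz
    have h4 := bothLarge_le T G G G (A := A) (A' := A') (z := z) (C := 2) hz.1
      (by linarith [hz.2]) zero_le_two (fun w hw => by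
        linarith [hA1 w (hA'1.trans hw) z hz]) x
    have h5 : G.real (window T A') * G.real (window T (x - A')) ≤ η * ((1 + 1) * g) :=
      mul_le_mul (hA2 A' hA'2) (hxs A' ⟨hA'4, le_rfl⟩) measureReal_nonneg hη0.le
    have h6 := mul_le_mul_of_nonneg_right hA hg0
    rw [hc]
    nlinarith
  have h7 : c * M.real (Iic B) ≤ (M.conv (G.conv G)).real (window T x) := by
    have h8 : c * M.real (Iic B) ≤ ((G.conv G).conv (M.restrict (Iic B))).real (window T x) := by
      refine mul_le_conv_restrict T _ M measurableSet_Iic ?_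
      filter_upwards [ae_nonneg hM0] with z hz hzB
      exact hcle z ⟨hz, hzB⟩
    rw [Measure.conv_comm] at h8
    exact h8.trans (conv_window_mono_left T Measure.restrict_le_self x)
  have h9 : c * (1 - η) ≤ (2 + η) * g :=
    (mul_le_mul_of_nonneg_left hB hc0).trans (h7.trans hx2)
  have h10 : bothLarge T G G A' x ≤ 20 * η * g := by
    rw [hc] at h9
    nlinarith [mul_nonneg hη0.le hg0, mul_nonneg (mul_nonneg hη0.le hη0.le) hg0,
      mul_le_mul_of_nonneg_right hη2 hJ0]
  exact h10.trans (mul_le_mul_of_nonneg_right (by linarith) hg0)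

theorem tendsto_conv_self_div {T : ℝ≥0∞} {G : Measure ℝ} [IsProbabilityMeasure G]
    (hpos : ∀ᶠ x in atTop, 0 < G.real (window T x)) (hG0 : G (Iio 0) = 0)
    (hs : ShiftGE fun x => G.real (window T x))
    (h2 : AsympLE (fun x => G.real (window T x)) (fun x => (G.conv G).real (window T x)) 2) :
    Tendsto (fun x : ℝ => (G.conv G).real (window T x) / (2 * G.real (window T x)))
      atTop (𝓝 1) := by
  have h1 : AsympGE (fun x => G.real (window T x)) (fun x => (G.conv G).real (window T x)) 2 := by
    simpa [convPow_two] using AsympGE.convPow hG0 hs 2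
  have := ((tendsto_div_iff_asymp hpos).2 ⟨h1, h2⟩).div_const 2
  simpa [div_div, mul_comm] using this

/-- For full tails, `limsup (G * G) / G ≤ 2` forces `G` to be long-tailed. -/
theorem longTailed_top_of_conv_self {G : Measure ℝ} [IsProbabilityMeasure G]
    (hpos : ∀ᶠ x in atTop, 0 < G.real (window ∞ x)) (hG1 : G (Iic 1) = 0)
    (h2 : AsympLE (fun x => G.real (window ∞ x)) (fun x => (G.conv G).real (window ∞ x)) 2) :
    LongTailed ∞ G := by
  have hG1' : ∀ᵐ y ∂G, 1 < y := by
    rw [ae_iff]; simpa [Iic_def] using hG1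
  have anti : ∀ {x y : ℝ}, x ≤ y → G.real (window ∞ y) ≤ G.real (window ∞ x) := by
    intro x y hxy
    rw [window_top, window_top]
    exact measureReal_mono (Ioi_subset_Ioi hxy)
  -- The first summand exceeds `1`, so a sum exceeds `x` if the second exceeds `x - 1`, and also
  -- if the first summand alone exceeds `x`.
  have key : ∀ x, G.real (window ∞ (x - 1)) * G.real (Iic x) + G.real (window ∞ x)
      ≤ (G.conv G).real (window ∞ x) := by
    intro x
    have h3 : G.real (window ∞ (x - 1)) * G.real (Iic x)
        ≤ (G.conv (G.restrict (Iic x))).real (window ∞ x) := by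
      refine mul_le_conv_restrict ∞ G G measurableSet_Iic ?_
      filter_upwards [hG1'] with y hy _
      exact anti (by linarith)
    have h4 : 1 * G.real (Ioi x) ≤ (G.conv (G.restrict (Ioi x))).real (window ∞ x) := by
      refine mul_le_conv_restrict ∞ G G measurableSet_Ioi (Eventually.of_forall fun y hy => ?_)
      have : G.real (Ioi (1 : ℝ)) = 1 := by
        rw [← compl_Iic, measureReal_compl measurableSet_Iic, measureReal_def, measureReal_def,
          hG1]
        simp
      rw [window_top, ← this]
      refine measureReal_mono (Ioi_subset_Ioi ?_)
      linarith [show x < y from hy]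
    have h5 : G.conv G = G.conv (G.restrict (Iic x)) + G.conv (G.restrict (Ioi x)) := by
      rw [← Measure.conv_add, ← compl_Iic,
        Measure.restrict_add_restrict_compl measurableSet_Iic]
    rw [h5, measureReal_add_apply]
    rw [one_mul] at h4
    rw [window_top x] at h3 h4 ⊢
    linarith
  refine ⟨inferInstance, hpos, ?_⟩
  rw [Metric.tendstoUniformlyOn_iff]
  intro ε hε
  set η := min (ε / 4) (1 / 4) with hη
  have hη0 : 0 < η := lt_min (by positivity) (by norm_num)
  have hη1 : η ≤ ε / 4 := min_le_left _ _
  have hη2 : η ≤ 1 / 4 := min_le_right _ _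
  obtain ⟨A, hA⟩ := exists_real_Iic_gt G hη0
  obtain ⟨x1, hx1⟩ := eventually_atTop.1 (h2 η hη0)
  filter_upwards [hpos, eventually_ge_atTop A, eventually_ge_atTop x1] with x hx hxA hxx t ht
  have h3 := key (x + 1)
  have h4 := hx1 (x + 1) (by linarith)
  have h5 := hA (x + 1) (by linarith)
  rw [add_sub_cancel_right] at h3
  rw [probReal_univ] at h5
  have h6 : G.real (window ∞ (x + 1)) ≤ G.real (window ∞ (x + t)) := anti (by linarith [ht.2])
  have h7 : G.real (window ∞ (x + t)) ≤ G.real (window ∞ x) := anti (by linarith [ht.1])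
  have h8 : G.real (window ∞ x) * (1 - η) ≤ (1 + η) * G.real (window ∞ (x + 1)) := by
    have := mul_le_mul_of_nonneg_left h5 hx.le
    simp only at h4
    linarith
  rw [Real.dist_eq, abs_sub_lt_iff]
  have h9 : 1 - 2 * η ≤ G.real (window ∞ (x + t)) / G.real (window ∞ x) := by
    rw [le_div_iff₀ hx]
    have h10 : (1 + η) * ((1 - 2 * η) * G.real (window ∞ x))
        ≤ (1 + η) * G.real (window ∞ (x + t)) := by
      nlinarith [mul_nonneg (sq_nonneg η) hx.le]
    exact le_of_mul_le_mul_left h10 (by linarith)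
  have h11 : G.real (window ∞ (x + t)) / G.real (window ∞ x) ≤ 1 := (div_le_one hx).2 h7
  constructor <;> linarith

/-- If smoothing a compound Poisson law with jump law `G` and mean number of jumps `m` has
`Δ`-tails asymptotic to `m * G (x + Δ)`, then `G` is `Δ`-subexponential. -/
theorem subexponential_of_tendsto {T : ℝ≥0∞} {G M : Measure ℝ} [IsProbabilityMeasure G]
    [IsProbabilityMeasure M] (hG1 : G (Iic 1) = 0) (hM0 : M (Iio 0) = 0)
    (hL : T ≠ ∞ → LongTailed T G) {m : ℝ} (hm : 0 < m)
    [IsFiniteMeasure (compoundPoisson (ENNReal.ofReal m • G))]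
    (hpos : ∀ᶠ x in atTop, 0 < G.real (window T x))
    (hF : Tendsto (fun x => (M.conv (compoundPoisson (ENNReal.ofReal m • G))).real (window T x)
      / G.real (window T x)) atTop (𝓝 m)) : Subexponential T G := by
  have hG0 : G (Iio 0) = 0 := measure_mono_null (fun y hy => by
    simp only [mem_Iio, mem_Iic] at hy ⊢; linarith) hG1
  have hunb : ∀ x : ℝ, 0 < G (Ioi x) := by
    intro x
    obtain ⟨y, hy1, hy2⟩ := (hpos.and (eventually_ge_atTop x)).exists
    refine (ENNReal.toReal_pos_iff.1 hy1).1.trans_le (measure_mono ?_)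
    exact (window_subset_Ioi T y).trans (Ioi_subset_Ioi hy2)
  have hle := ((tendsto_div_iff_asymp hpos).1 hF).2
  by_cases hT : T = ∞
  · subst hT
    -- Full tails are monotone, so no long-tail hypothesis is needed for the lower bounds.
    have hs : ShiftGE fun x => G.real (window ∞ x) := by
      intro A ε hε
      refine Eventually.of_forall fun x y hy => ?_
      have h1 : G.real (window ∞ x) ≤ G.real (window ∞ (x - y)) := by
        rw [window_top, window_top]
        exact measureReal_mono (Ioi_subset_Ioi (by linarith [hy.1]))
      nlinarith [measureReal_nonneg (μ := G) (s := window ∞ x)]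
    have h2 := asympLE_conv_conv_self hG0 hM0 hs hm hle
    have h3 : AsympLE (fun x => G.real (window ∞ x))
        (fun x => (G.conv G).real (window ∞ x)) 2 := by
      intro ε hε
      filter_upwards [h2 ε hε] with x hx
      refine le_trans ?_ hx
      have := mul_le_conv_restrict ∞ (G.conv G) M MeasurableSet.univ (x := x)
        (c := (G.conv G).real (window ∞ x)) (by
          filter_upwards [ae_nonneg hM0] with y hy _
          rw [window_top, window_top]
          exact measureReal_mono (Ioi_subset_Ioi (by linarith)))
      rwa [probReal_univ, mul_one, Measure.restrict_univ, Measure.conv_comm _ M] at this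
    exact ⟨hG0, hunb, longTailed_top_of_conv_self hpos hG1 h3,
      tendsto_conv_self_div hpos hG0 hs h3⟩
  · have hlong := hL hT
    obtain ⟨hs1, hs2⟩ := hlong.shift
    have h2 := asympLE_conv_conv_self hG0 hM0 hs1 hm hle
    have hJ := hlong.negligibleBoth_of_conv hG0 hM0 h2
    refine ⟨hG0, hunb, hlong, tendsto_conv_self_div hpos hG0 hs1 ?_⟩
    simpa [convPow_two] using AsympLE.convPow hG0 hs2 hJ 2

/-! ### Exponential moments and Laplace transforms -/

/-- The exponential moment `∫ exp (t x) M(dx)`, which may be infinite. -/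
noncomputable def expMoment (M : Measure ℝ) (t : ℝ) : ℝ≥0∞ :=
  ∫⁻ x, ENNReal.ofReal (Real.exp (t * x)) ∂M

theorem expMoment_zero (M : Measure ℝ) : expMoment M 0 = M univ := by
  simp [expMoment]

theorem expMoment_dirac (a t : ℝ) :
    expMoment (Measure.dirac a) t = ENNReal.ofReal (Real.exp (t * a)) := by
  rw [expMoment, lintegral_dirac]

theorem expMoment_smul (c : ℝ≥0∞) (M : Measure ℝ) (t : ℝ) :
    expMoment (c • M) t = c * expMoment M t := by
  rw [expMoment, lintegral_smul_measure, smul_eq_mul, expMoment]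

theorem expMoment_conv (M N : Measure ℝ) [SFinite N] (t : ℝ) :
    expMoment (M.conv N) t = expMoment M t * expMoment N t := by
  rw [expMoment, Measure.lintegral_conv (by fun_prop)]
  simp_rw [mul_add, Real.exp_add, ENNReal.ofReal_mul (Real.exp_pos _).le]
  simp_rw [lintegral_const_mul _ (show Measurable fun y : ℝ => ENNReal.ofReal (Real.exp (t * y))
    by fun_prop)]
  rw [lintegral_mul_const _ (by fun_prop)]
  rfl

theorem expMoment_convPow (M : Measure ℝ) [IsFiniteMeasure M] (n : ℕ) (t : ℝ) :
    expMoment (convPow M n) t = expMoment M t ^ n := by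
  induction n with
  | zero => simp [convPow, expMoment_dirac]
  | succ n ih => rw [convPow, expMoment_conv, ih, pow_succ]

theorem expMoment_eq_ofReal {M : Measure ℝ} {t : ℝ}
    (h : Integrable (fun x => Real.exp (t * x)) M) :
    expMoment M t = ENNReal.ofReal (∫ x, Real.exp (t * x) ∂M) :=
  (ofReal_integral_eq_lintegral_ofReal h (Eventually.of_forall fun _ => (Real.exp_pos _).le)).symm

theorem expMoment_compoundPoisson (ρ : Measure ℝ) [IsFiniteMeasure ρ] {t : ℝ}
    (h : Integrable (fun x => Real.exp (t * x) - 1) ρ) :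
    expMoment (compoundPoisson ρ) t
      = ENNReal.ofReal (Real.exp (∫ x, (Real.exp (t * x) - 1) ∂ρ)) := by
  have hI : Integrable (fun x => Real.exp (t * x)) ρ := by
    refine (h.add (integrable_const (1 : ℝ))).congr (Eventually.of_forall fun x => ?_)
    simp
  set I := ∫ x, Real.exp (t * x) ∂ρ with hIdef
  have hI0 : 0 ≤ I := integral_nonneg fun _ => (Real.exp_pos _).le
  have e1 : ∫ x, (Real.exp (t * x) - 1) ∂ρ = I - ρ.real univ := by
    rw [integral_sub hI (integrable_const _)]; simp [hIdef]
  rw [expMoment, compoundPoisson, lintegral_sum_measure]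
  have e2 : ∀ n : ℕ, ∫⁻ x, ENNReal.ofReal (Real.exp (t * x))
      ∂(ENNReal.ofReal (Real.exp (-ρ.real univ) / n.factorial) • convPow ρ n)
      = ENNReal.ofReal (Real.exp (-ρ.real univ) * (I ^ n / n.factorial)) := by
    intro n
    change expMoment _ t = _
    rw [expMoment_smul, expMoment_convPow, expMoment_eq_ofReal hI, ← ENNReal.ofReal_pow hI0,
      ← ENNReal.ofReal_mul (by positivity)]
    congr 1
    ring
  have hsum := (NormedSpace.expSeries_div_hasSum_exp (𝔸 := ℝ) I).mul_left
    (Real.exp (-ρ.real univ))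
  simp_rw [e2]
  rw [← ENNReal.ofReal_tsum_of_nonneg (fun n => by positivity) hsum.summable, hsum.tsum_eq,
    ← Real.exp_eq_exp_ℝ, ← Real.exp_add, e1]
  congr 2
  ring

instance isProbabilityMeasure_compoundPoisson (ρ : Measure ℝ) [IsFiniteMeasure ρ] :
    IsProbabilityMeasure (compoundPoisson ρ) := by
  constructor
  rw [← expMoment_zero, expMoment_compoundPoisson ρ (by simp)]
  simp

theorem compoundPoisson_Iio_zero {ρ : Measure ℝ} [IsFiniteMeasure ρ] (h : ρ (Iio 0) = 0) :
    compoundPoisson ρ (Iio 0) = 0 := by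
  rw [compoundPoisson, Measure.sum_apply _ measurableSet_Iio]
  simp [convPow_Iio_zero h]

theorem integrable_exp_neg_mul {M : Measure ℝ} [IsFiniteMeasure M] (hM : M (Iio 0) = 0)
    {t : ℝ} (ht : t ≤ 0) : Integrable (fun x => Real.exp (t * x)) M := by
  refine Integrable.of_bound (by fun_prop) 1 ?_
  filter_upwards [ae_nonneg hM] with x hx
  rw [Real.norm_of_nonneg (Real.exp_pos _).le, Real.exp_le_one_iff]
  exact mul_nonpos_of_nonpos_of_nonneg ht hx

/-- A finite measure on `[0, ∞)` is determined by its Laplace transform: the transform extends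
analytically to a half-plane and continuously to its boundary, where it is the characteristic
function. -/
theorem ext_of_laplace {M N : Measure ℝ} [IsFiniteMeasure M] [IsFiniteMeasure N]
    (hM : M (Iio 0) = 0) (hN : N (Iio 0) = 0)
    (h : ∀ l : ℝ, 0 < l → ∫ x, Real.exp (-l * x) ∂M = ∫ x, Real.exp (-l * x) ∂N) : M = N := by
  set U : Set ℂ := {z | z.re < 0} with hU
  have hint : ∀ {K : Measure ℝ} [IsFiniteMeasure K], K (Iio 0) = 0 →
      AnalyticOnNhd ℂ (complexMGF id K) U := by
    intro K _ hK
    refine analyticOnNhd_complexMGF.mono fun z hz => ?_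
    refine interior_mono (s := Iio 0) ?_ ?_
    · intro t ht
      exact integrable_exp_neg_mul hK (le_of_lt ht)
    · rw [interior_Iio]; exact hz
  have hpre : IsPreconnected U :=
    ((convex_Iio (0 : ℝ)).linear_preimage Complex.reLm).isPreconnected
  have heq : EqOn (complexMGF id M) (complexMGF id N) U := by
    refine (hint hM).eqOn_of_preconnected_of_frequently_eq (hint hN) hpre
      (z₀ := ((-1 : ℝ) : ℂ)) (by simp [hU]) ?_
    have h_real : ∃ᶠ x : ℝ in 𝓝[≠] (-1), complexMGF id M x = complexMGF id N x := by
      refine Eventually.frequently ?_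
      have : ∀ᶠ x : ℝ in 𝓝[≠] (-1), x < 0 :=
        nhdsWithin_le_nhds (Iio_mem_nhds (by norm_num))
      filter_upwards [this] with x hx
      rw [complexMGF_ofReal, complexMGF_ofReal]
      have := h (-x) (by linarith)
      rw [neg_neg] at this
      simp only [mgf, id, this]
    rw [frequently_iff_seq_forall] at h_real ⊢
    obtain ⟨xs, hx_tendsto, hx_eq⟩ := h_real
    refine ⟨fun n => xs n, ?_, fun n => hx_eq n⟩
    rw [tendsto_nhdsWithin_iff] at hx_tendsto ⊢
    constructor
    · exact (Complex.continuous_ofReal.tendsto _).comp hx_tendsto.1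
    · filter_upwards [hx_tendsto.2] with n hn
      simpa using fun h => hn (by exact_mod_cast h)
  have hlim : ∀ {K : Measure ℝ} [IsFiniteMeasure K], K (Iio 0) = 0 → ∀ t : ℝ,
      Tendsto (fun n : ℕ => complexMGF id K (-(1 / ((n : ℝ) + 1) : ℝ) + t * Complex.I)) atTop
        (𝓝 (charFun K t)) := by
    intro K _ hK t
    rw [← complexMGF_id_mul_I]
    refine tendsto_integral_of_dominated_convergence (fun _ => 1) (fun n => ?_)
      (integrable_const 1) (fun n => ?_) ?_
    · exact (by fun_prop : Continuous _).aestronglyMeasurable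
    · filter_upwards [ae_nonneg hK] with x hx
      rw [Complex.norm_exp, Real.exp_le_one_iff]
      have : 0 < 1 / ((n : ℝ) + 1) := by positivity
      rw [id_eq, Complex.re_mul_ofReal, Complex.add_re, Complex.neg_re, Complex.ofReal_re,
        Complex.re_ofReal_mul, Complex.I_re, mul_zero, add_zero]
      exact mul_nonpos_of_nonpos_of_nonneg (by linarith) hx
    · refine Eventually.of_forall fun x => ?_
      have h0 := (Complex.continuous_ofReal.tendsto _).comp
        (tendsto_one_div_add_atTop_nhds_zero_nat (𝕜 := ℝ))
      have h1 : Tendsto (fun n : ℕ => (-((1 / ((n : ℝ) + 1) : ℝ) : ℂ) + t * Complex.I)) atTop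
          (𝓝 (t * Complex.I)) := by
        simpa using (h0.neg).add_const ((t : ℂ) * Complex.I)
      exact (Complex.continuous_exp.tendsto _).comp (h1.mul_const _)
  refine Measure.ext_of_charFun (funext fun t => ?_)
  refine tendsto_nhds_unique (hlim hM t) ((hlim hN t).congr fun n => (heq ?_).symm)
  have : 0 < 1 / ((n : ℝ) + 1) := by positivity
  simp only [hU, mem_ofPred_eq, Complex.add_re, Complex.neg_re, Complex.ofReal_re,
    Complex.mul_re, Complex.I_re, Complex.I_im, Complex.ofReal_im]
  linarith

/-! ### The law of an infinite sum -/

/-- The law of a convergent sum of independent nonnegative variables with laws `N k`. Bounded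
exponential moments of order two of the partial sums ensure convergence. -/
theorem exists_law_of_sum (N : ℕ → Measure ℝ) [∀ k, IsProbabilityMeasure (N k)]
    (hN : ∀ k, N k (Iio 0) = 0) {C : ℝ}
    (hC : ∀ n, ∏ k ∈ Finset.range n, expMoment (N k) 2 ≤ ENNReal.ofReal C) :
    ∃ M : Measure ℝ, IsProbabilityMeasure M ∧ M (Iio 0) = 0 ∧ expMoment M 2 ≠ ∞ ∧
      ∀ t ≤ 0, Tendsto (fun n => ∏ k ∈ Finset.range n, expMoment (N k) t) atTop
        (𝓝 (expMoment M t)) := by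
  set P := Measure.infinitePi N with hP
  set S : ℕ → (ℕ → ℝ) → ℝ := fun n ω => ∑ k ∈ Finset.range n, ω k with hS
  have hSm : ∀ n, Measurable (S n) := fun n => by fun_prop
  have hprod : ∀ n t, ∫⁻ ω, ENNReal.ofReal (Real.exp (t * S n ω)) ∂P
      = ∏ k ∈ Finset.range n, expMoment (N k) t := by
    intro n t
    have hind : iIndepFun (fun k (ω : ℕ → ℝ) => ENNReal.ofReal (Real.exp (t * ω k))) P :=
      iIndepFun_infinitePi (X := fun _ x => ENNReal.ofReal (Real.exp (t * x)))
        (fun _ => by fun_prop)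
    have h1 := lintegral_prod_eq_prod_lintegral_of_indepFun (Finset.range n) _ hind
      (fun k => by fun_prop)
    have h2 : ∀ k, ∫⁻ ω, ENNReal.ofReal (Real.exp (t * ω k)) ∂P = expMoment (N k) t := by
      intro k
      rw [expMoment, ← Measure.infinitePi_map_eval N k, lintegral_map (by fun_prop) (by fun_prop)]
    simp_rw [h2] at h1
    rw [← h1]
    refine lintegral_congr fun ω => ?_
    rw [← ENNReal.ofReal_prod_of_nonneg fun _ _ => (Real.exp_pos _).le, ← Real.exp_sum, hS,
      Finset.mul_sum]
  have hnn : ∀ᵐ ω ∂P, ∀ k, 0 ≤ ω k := by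
    rw [ae_all_iff]
    intro k
    have := ae_nonneg (hN k)
    rw [← Measure.infinitePi_map_eval N k] at this
    exact ae_of_ae_map (measurable_pi_apply k).aemeasurable this
  -- By Fatou's lemma the partial sums, which increase almost surely, are almost surely bounded.
  have hfatou : ∫⁻ ω, liminf (fun n => ENNReal.ofReal (Real.exp (2 * S n ω))) atTop ∂P
      ≤ ENNReal.ofReal C := by
    refine (lintegral_liminf_le fun n => by fun_prop).trans ?_
    refine liminf_le_of_le (by isBoundedDefault) fun b hb => ?_
    obtain ⟨n, hn⟩ := hb.exists
    rw [hprod] at hn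
    exact hn.trans (hC n)
  have hsummable : ∀ᵐ ω ∂P, Summable ω := by
    have hfin := ae_lt_top' (μ := P) (f := fun ω => liminf (fun n =>
      ENNReal.ofReal (Real.exp (2 * S n ω))) atTop)
      (Measurable.liminf fun n => by fun_prop).aemeasurable
      (hfatou.trans_lt ENNReal.ofReal_lt_top).ne
    filter_upwards [hfin, hnn] with ω hω h0
    obtain ⟨c, hc, -⟩ := ENNReal.lt_iff_exists_nnreal_btwn.1 hω
    have hfreq := frequently_lt_of_liminf_lt (by isBoundedDefault) hc
    refine summable_of_sum_range_le (c := c) h0 fun n => ?_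
    obtain ⟨k, hk, hnk⟩ := (hfreq.and_eventually (eventually_ge_atTop n)).exists
    have hmono : S n ω ≤ S k ω := Finset.sum_le_sum_of_subset_of_nonneg
      (Finset.range_mono hnk) fun i _ _ => h0 i
    have hSn : 0 ≤ S k ω := Finset.sum_nonneg fun i _ => h0 i
    have h1 : Real.exp (2 * S k ω) ≤ c := by
      have := ENNReal.toReal_mono ENNReal.coe_ne_top hk.le
      rwa [ENNReal.toReal_ofReal (Real.exp_pos _).le] at this
    have h2 := Real.add_one_le_exp (2 * S k ω)
    change S n ω ≤ c
    linarith
  set Z : (ℕ → ℝ) → ℝ := fun ω => ∑' k, ω k with hZ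
  have hlim : ∀ᵐ ω ∂P, Tendsto (fun n => S n ω) atTop (𝓝 (Z ω)) := by
    filter_upwards [hsummable] with ω hω
    exact hω.hasSum.tendsto_sum_nat
  have hZm : AEMeasurable Z P :=
    aemeasurable_of_tendsto_metrizable_ae atTop (fun n => (hSm n).aemeasurable) hlim
  have hexpZ : ∀ t, expMoment (P.map Z) t = ∫⁻ ω, ENNReal.ofReal (Real.exp (t * Z ω)) ∂P :=
    fun t => lintegral_map' (by fun_prop) hZm
  have hexplim : ∀ t, ∀ᵐ ω ∂P, Tendsto (fun n => ENNReal.ofReal (Real.exp (t * S n ω))) atTop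
      (𝓝 (ENNReal.ofReal (Real.exp (t * Z ω)))) := by
    intro t
    filter_upwards [hlim] with ω hω
    exact (ENNReal.continuous_ofReal.tendsto _).comp
      ((Real.continuous_exp.tendsto _).comp (hω.const_mul t))
  refine ⟨P.map Z, Measure.isProbabilityMeasure_map hZm, ?_, ?_, ?_⟩
  · rw [Measure.map_apply_of_aemeasurable hZm measurableSet_Iio, measure_eq_zero_iff_ae_notMem]
    filter_upwards [hnn] with ω hω
    simp only [mem_preimage, mem_Iio, not_lt]
    exact tsum_nonneg hω
  · rw [hexpZ]
    refine ne_top_of_le_ne_top ENNReal.ofReal_ne_top (le_trans (le_of_eq ?_) hfatou)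
    refine lintegral_congr_ae ?_
    filter_upwards [hexplim 2] with ω hω
    exact hω.liminf_eq.symm
  · intro t ht
    simp_rw [← hprod, hexpZ]
    refine tendsto_lintegral_of_dominated_convergence (fun _ => 1) (fun n => by fun_prop)
      (fun n => ?_) (by simp) (hexplim t)
    filter_upwards [hnn] with ω hω
    rw [ENNReal.ofReal_le_one, Real.exp_le_one_iff]
    exact mul_nonpos_of_nonpos_of_nonneg ht (Finset.sum_nonneg fun i _ => hω i)

/-! ### The decomposition of an infinitely divisible law -/

theorem integrableOn_exp_sub_one {ν : Measure ℝ}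
    (hsmall : ∫⁻ x in Ioc (0 : ℝ) 1, ENNReal.ofReal x ∂ν < ∞) (t : ℝ) :
    IntegrableOn (fun x => Real.exp (t * x) - 1) (Ioc 0 1) ν := by
  have hx : IntegrableOn (fun x : ℝ => x) (Ioc 0 1) ν := by
    refine ⟨by fun_prop, ?_⟩
    rw [hasFiniteIntegral_iff_ofReal]
    · exact hsmall
    · filter_upwards [ae_restrict_mem measurableSet_Ioc] with x hx using hx.1.le
  refine Integrable.mono' (hx.const_mul (|t| * Real.exp |t|)) (by fun_prop) ?_
  filter_upwards [ae_restrict_mem measurableSet_Ioc] with x hx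
  rw [Real.norm_eq_abs, abs_le]
  have h1 := Real.add_one_le_exp (t * x)
  have h2 := Real.add_one_le_exp (-(t * x))
  have h3 : Real.exp (t * x) * Real.exp (-(t * x)) = 1 := by rw [← Real.exp_add]; simp
  have h4 : |t * x| ≤ |t| := by
    rw [abs_mul, abs_of_pos hx.1]
    exact mul_le_of_le_one_right (abs_nonneg t) hx.2
  have h5 : Real.exp (t * x) ≤ Real.exp |t| := Real.exp_le_exp.2 ((le_abs_self _).trans h4)
  have h6 : |t| * x = |t * x| := by rw [abs_mul, abs_of_pos hx.1]
  have h7 : |t| * Real.exp |t| * x = |t * x| * Real.exp |t| := by rw [← h6]; ring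
  have h8 : 1 ≤ Real.exp |t| := Real.one_le_exp (abs_nonneg t)
  rw [h7]
  have h9 := le_abs_self (t * x)
  have h10 := neg_abs_le (t * x)
  have h11 := abs_nonneg (t * x)
  constructor
  · nlinarith
  · -- `exp u - 1 ≤ u * exp u`, since `exp (-u) ≥ 1 - u`
    have h12 : Real.exp (t * x) - 1 ≤ t * x * Real.exp (t * x) := by
      nlinarith [Real.exp_pos (t * x)]
    calc Real.exp (t * x) - 1 ≤ t * x * Real.exp (t * x) := h12
      _ ≤ |t * x| * Real.exp (t * x) := mul_le_mul_of_nonneg_right h9 (Real.exp_pos _).le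
      _ ≤ |t * x| * Real.exp |t| := mul_le_mul_of_nonneg_left h5 h11

theorem iUnion_Ioc_one_div : ⋃ k : ℕ, Ioc (1 / ((k + 1 : ℕ) + 1 : ℝ)) (1 / ((k : ℝ) + 1))
    = Ioc (0 : ℝ) 1 := by
  ext x
  simp only [mem_iUnion, mem_Ioc]
  constructor
  · rintro ⟨k, h1, h2⟩
    refine ⟨lt_trans (by positivity) h1, h2.trans ?_⟩
    rw [div_le_one (by positivity)]
    linarith [show (0 : ℝ) ≤ k from Nat.cast_nonneg k]
  · rintro ⟨h1, h2⟩
    have hex : ∃ n : ℕ, 1 / ((n : ℝ) + 1) < x := exists_nat_one_div_lt h1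
    classical
    obtain ⟨k, hk⟩ : ∃ k, Nat.find hex = k + 1 := by
      refine Nat.exists_eq_succ_of_ne_zero fun h => ?_
      have := Nat.find_spec hex
      rw [h] at this
      simp only [Nat.cast_zero, zero_add, div_one] at this
      linarith
    refine ⟨k, ?_, ?_⟩
    · have := Nat.find_spec hex
      rwa [hk] at this
    · exact not_lt.1 (Nat.find_min hex (by omega : k < Nat.find hex))

/-- The law with Lévy measure `ν` restricted to `(0, 1]` and no drift, obtained as an infinite
convolution of compound Poisson laws with jumps in `(1 / (k + 2), 1 / (k + 1)]`. Since its jumps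
are bounded, it has exponential moments. -/
theorem exists_law_of_small_jumps {ν : Measure ℝ}
    (hsmall : ∫⁻ x in Ioc (0 : ℝ) 1, ENNReal.ofReal x ∂ν < ∞) :
    ∃ M : Measure ℝ, IsProbabilityMeasure M ∧ M (Iio 0) = 0 ∧ expMoment M 2 ≠ ∞ ∧
      ∀ t ≤ 0, expMoment M t
        = ENNReal.ofReal (Real.exp (∫ x in Ioc (0 : ℝ) 1, (Real.exp (t * x) - 1) ∂ν)) := by
  set J : ℕ → Set ℝ := fun k => Ioc (1 / ((k + 1 : ℕ) + 1 : ℝ)) (1 / ((k : ℝ) + 1)) with hJ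
  have hJU : ⋃ k, J k = Ioc 0 1 := iUnion_Ioc_one_div
  have hJsub : ∀ k, J k ⊆ Ioc 0 1 := fun k => hJU ▸ subset_iUnion J k
  have hJm : ∀ k, MeasurableSet (J k) := fun k => measurableSet_Ioc
  have hJd : Pairwise (Function.onFun Disjoint J) := by
    have hanti : Antitone fun k : ℕ => 1 / ((k : ℝ) + 1) :=
      fun a b hab => one_div_le_one_div_of_le (by positivity) (by gcongr)
    exact hanti.pairwise_disjoint_on_Ioc_succ
  have hfin : ∀ k, IsFiniteMeasure (ν.restrict (J k)) := by
    intro k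
    refine ⟨?_⟩
    rw [Measure.restrict_apply_univ]
    set c : ℝ := 1 / ((k + 1 : ℕ) + 1 : ℝ) with hc
    have hc0 : 0 < c := by positivity
    have h1 : ENNReal.ofReal c * ν (J k) ≤ ∫⁻ x in Ioc (0 : ℝ) 1, ENNReal.ofReal x ∂ν := by
      calc ENNReal.ofReal c * ν (J k) = ∫⁻ _ in J k, ENNReal.ofReal c ∂ν := by simp
        _ ≤ ∫⁻ x in J k, ENNReal.ofReal x ∂ν :=
            setLIntegral_mono (by fun_prop) fun x hx => ENNReal.ofReal_le_ofReal hx.1.le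
        _ ≤ _ := lintegral_mono_set (hJsub k)
    refine ENNReal.lt_top_of_mul_ne_top_right (h1.trans_lt hsmall).ne ?_
    simpa using hc0
  have hint : ∀ t k, Integrable (fun x => Real.exp (t * x) - 1) (ν.restrict (J k)) :=
    fun t k => (integrableOn_exp_sub_one hsmall t).mono_set (hJsub k)
  have hsum : ∀ t, HasSum (fun k => ∫ x in J k, (Real.exp (t * x) - 1) ∂ν)
      (∫ x in Ioc (0 : ℝ) 1, (Real.exp (t * x) - 1) ∂ν) := by
    intro t
    rw [← hJU]
    refine hasSum_integral_iUnion hJm hJd ?_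
    rw [hJU]
    exact integrableOn_exp_sub_one hsmall t
  have hprod : ∀ n t, ∏ k ∈ Finset.range n, expMoment (compoundPoisson (ν.restrict (J k))) t
      = ENNReal.ofReal (Real.exp
        (∑ k ∈ Finset.range n, ∫ x in J k, (Real.exp (t * x) - 1) ∂ν)) := by
    intro n t
    rw [Real.exp_sum, ENNReal.ofReal_prod_of_nonneg fun _ _ => (Real.exp_pos _).le]
    exact Finset.prod_congr rfl fun k _ => expMoment_compoundPoisson _ (hint t k)
  have hneg : ∀ k, compoundPoisson (ν.restrict (J k)) (Iio 0) = 0 := by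
    intro k
    refine compoundPoisson_Iio_zero ?_
    rw [Measure.restrict_apply measurableSet_Iio]
    have : Iio 0 ∩ J k = ∅ := by
      ext x
      simp only [mem_inter_iff, mem_Iio, mem_empty_iff_false, iff_false, not_and]
      intro h1 h2
      linarith [(hJsub k h2).1]
    simp [this]
  obtain ⟨M, hM1, hM2, hM3, hM4⟩ := exists_law_of_sum
    (fun k => compoundPoisson (ν.restrict (J k))) hneg
    (C := Real.exp (∫ x in Ioc (0 : ℝ) 1, (Real.exp (2 * x) - 1) ∂ν)) (by
      intro n
      rw [hprod]
      refine ENNReal.ofReal_le_ofReal (Real.exp_le_exp.2 (sum_le_hasSum _ (fun k _ => ?_) (hsum 2)))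
      refine setIntegral_nonneg (hJm k) fun x hx => ?_
      have := Real.add_one_le_exp (2 * x)
      linarith [(hJsub k hx).1])
  refine ⟨M, hM1, hM2, hM3, fun t ht => tendsto_nhds_unique (hM4 t ht) ?_⟩
  simp_rw [hprod]
  exact (ENNReal.continuous_ofReal.tendsto _).comp
    ((Real.continuous_exp.tendsto _).comp (hsum t).tendsto_sum_nat)

/-- A law on `[0, ∞)` with Lévy measure `ν` is the convolution of a law with light tails, which
carries the drift and the jumps of size at most `1`, and the compound Poisson law of the jumps
larger than `1`. -/
theorem IsLevyMeasure.exists_eq_conv {F ν : Measure ℝ} [IsProbabilityMeasure F]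
    (hF0 : F (Iio 0) = 0) (h : IsLevyMeasure F ν) :
    ∃ M : Measure ℝ, IsProbabilityMeasure M ∧ M (Iio 0) = 0 ∧ expMoment M 2 ≠ ∞ ∧
      F = M.conv (compoundPoisson (ν.restrict (Ioi 1))) := by
  obtain ⟨a, ha, hlap⟩ := h.laplace
  obtain ⟨M, hM1, hM2, hM3, hM4⟩ := exists_law_of_small_jumps h.small_jumps
  have hfin : IsFiniteMeasure (ν.restrict (Ioi 1)) := ⟨by simpa using h.tail_finite⟩
  have hdir : Measure.dirac a (Iio 0) = 0 := by simp [ha]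
  have hMa : (M.conv (Measure.dirac a)) (Iio 0) = 0 := conv_Iio_zero hM2 hdir
  have hρ : (ν.restrict (Ioi 1)) (Iio 0) = 0 := by
    rw [Measure.restrict_apply measurableSet_Iio]
    have : Iio (0 : ℝ) ∩ Ioi 1 = ∅ := by
      ext x
      simp only [mem_inter_iff, mem_Iio, mem_Ioi, mem_empty_iff_false, iff_false, not_and]
      intro h1 h2
      linarith
    simp [this]
  have hR := conv_Iio_zero hMa (compoundPoisson_Iio_zero hρ)
  refine ⟨M.conv (Measure.dirac a), inferInstance, hMa, ?_, ext_of_laplace hF0 hR fun l hl => ?_⟩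
  · rw [expMoment_conv, expMoment_dirac]
    exact ENNReal.mul_ne_top hM3 ENNReal.ofReal_ne_top
  have hl' : -l ≤ 0 := by linarith
  have hlarge : IntegrableOn (fun x => Real.exp (-l * x) - 1) (Ioi 1) ν :=
    (integrable_exp_neg_mul hρ hl').sub (integrable_const 1)
  have hsmall := integrableOn_exp_sub_one h.small_jumps (-l)
  have hsplit : -a * l - ∫ x in Ioi (0 : ℝ), (1 - Real.exp (-l * x)) ∂ν
      = (∫ x in Ioc (0 : ℝ) 1, (Real.exp (-l * x) - 1) ∂ν) + -l * a
        + ∫ x in Ioi (1 : ℝ), (Real.exp (-l * x) - 1) ∂ν := by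
    have e1 : ∫ x in Ioi (0 : ℝ), (1 - Real.exp (-l * x)) ∂ν
        = -∫ x in Ioi (0 : ℝ), (Real.exp (-l * x) - 1) ∂ν := by
      rw [← integral_neg]
      simp
    have e2 : Ioi (0 : ℝ) = Ioc 0 1 ∪ Ioi 1 := (Ioc_union_Ioi_eq_Ioi zero_le_one).symm
    rw [e1, e2, setIntegral_union (by
      rw [Set.disjoint_left]; intro x hx hx2; exact absurd hx.2 (not_le.2 hx2))
      measurableSet_Ioi hsmall hlarge]
    ring
  have key : expMoment ((M.conv (Measure.dirac a)).conv (compoundPoisson (ν.restrict (Ioi 1)))) (-l)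
      = ENNReal.ofReal (Real.exp (-a * l - ∫ x in Ioi (0 : ℝ), (1 - Real.exp (-l * x)) ∂ν)) := by
    rw [expMoment_conv, expMoment_conv, expMoment_dirac, hM4 _ hl',
      expMoment_compoundPoisson _ hlarge, hsplit, Real.exp_add, Real.exp_add,
      ENNReal.ofReal_mul (by positivity), ENNReal.ofReal_mul (by positivity)]
  rw [hlap l hl]
  have hnn := integral_nonneg (μ := (M.conv (Measure.dirac a)).conv
    (compoundPoisson (ν.restrict (Ioi 1)))) (f := fun x => Real.exp (-l * x))
    fun _ => (Real.exp_pos _).le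
  rw [expMoment_eq_ofReal (integrable_exp_neg_mul hR hl')] at key
  exact ((ENNReal.ofReal_eq_ofReal_iff hnn (Real.exp_pos _).le).1 key).symm

end LocalSubexp

theorem mainTheorem7 (T : ℝ≥0∞) (hT : 0 < T)
    (F : Measure ℝ) [IsProbabilityMeasure F] (hF_nonneg : F (Iio 0) = 0)
    (hF : LocalSubexp.InfinitelyDivisible F)
    (ν : Measure ℝ) (hν : LocalSubexp.IsLevyMeasure F ν) (hμ : 0 < ν (Ioi 1))
    (G : Measure ℝ) (hG : G = (ν (Ioi 1))⁻¹ • ν.restrict (Ioi 1))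
    (hL : T ≠ ∞ → LocalSubexp.LongTailed T G) :
    LocalSubexp.Subexponential T G ↔
      Tendsto (fun x : ℝ =>
        ν.real (LocalSubexp.window T x) / F.real (LocalSubexp.window T x)) atTop (𝓝 1) := by
  open LocalSubexp in
  set m := (ν (Ioi 1)).toReal with hm_def
  have hm : 0 < m := ENNReal.toReal_pos hμ.ne' hν.tail_finite.ne
  have hmν : ENNReal.ofReal m = ν (Ioi 1) := ENNReal.ofReal_toReal hν.tail_finite.ne
  have hGν : ENNReal.ofReal m • G = ν.restrict (Ioi 1) := by
    rw [hG, smul_smul, hmν, ENNReal.mul_inv_cancel hμ.ne' hν.tail_finite.ne, one_smul]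
  have hGprob : IsProbabilityMeasure G := ⟨by
    rw [hG, Measure.smul_apply, Measure.restrict_apply_univ, smul_eq_mul,
      ENNReal.inv_mul_cancel hμ.ne' hν.tail_finite.ne]⟩
  have hG1 : G (Iic 1) = 0 := by
    rw [hG, Measure.smul_apply, Measure.restrict_apply measurableSet_Iic, Iic_inter_Ioi]
    simp
  have hνG : ∀ᶠ x in atTop, ν.real (window T x) = m * G.real (window T x) := by
    filter_upwards [eventually_ge_atTop 1] with x hx
    have hsub : window T x ⊆ Ioi 1 := (window_subset_Ioi T x).trans (Ioi_subset_Ioi hx)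
    rw [← ENNReal.toReal_ofReal hm.le, ← measureReal_ennreal_smul_apply, hGν,
      measureReal_restrict_apply (measurableSet_window T x), inter_eq_left.2 hsub]
  have hfin : IsFiniteMeasure (ν.restrict (Ioi 1)) := ⟨by simpa using hν.tail_finite⟩
  obtain ⟨M, hMprob, hM0, hM2, hFM⟩ := hν.exists_eq_conv hF_nonneg
  have hR0 : ν.restrict (Ioi 1) (Iio 0) = 0 := by
    rw [← hGν, Measure.smul_apply, measure_mono_null (fun y hy => ?_) hG1, smul_zero]
    simp only [mem_Iio, mem_Iic] at hy ⊢
    linarith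
  have hC0 := compoundPoisson_Iio_zero hR0
  rw [← hGν] at hFM hC0 hfin
  constructor
  · intro hS
    have h1 := hS.tendsto_conv M _ hM0 hC0 hM2 hm.le (hS.tendsto_compoundPoisson hm.le)
    rw [← hFM] at h1
    have h2 := h1.inv₀ hm.ne' |>.const_mul m
    rw [mul_inv_cancel₀ hm.ne'] at h2
    refine h2.congr' ?_
    filter_upwards [hνG] with x hx
    rw [hx, inv_div, mul_div_assoc]
  · intro hS
    have hpos : ∀ᶠ x in atTop, 0 < G.real (window T x) := by
      filter_upwards [hνG, hS.eventually_ne one_ne_zero] with x hx hne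
      refine lt_of_le_of_ne measureReal_nonneg fun h0 => hne ?_
      rw [hx, ← h0]
      simp
    refine subexponential_of_tendsto hG1 hM0 hL hm hpos ?_
    rw [← hFM]
    have h2 := (hS.inv₀ one_ne_zero).const_mul m
    rw [inv_one, mul_one] at h2
    refine h2.congr' ?_
    filter_upwards [hνG, hpos] with x hx hp
    rw [hx, inv_div, mul_div_assoc']
    rw [mul_div_mul_left _ _ hm.ne']
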